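/- Let $\mathfrak g$ be an oriented 4-dimensional real Lie algebra that is unimodular, i.e. $\operatorname{tr}(\operatorname{ad}_\xi)=0$ for all $\xi\in\mathfrak g$. Let $d$ be the Chevalley–Eilenberg differential on $\Lambda^*(\mathfrak g^*)$ (so $d\varphi(u,v)=-\varphi([u,v])$ for $\varphi\in\mathfrak g^*$), let $\mathcal Z$ and $\mathcal B$ be the spaces of closed and of exact 2-forms, and let $H^2(\mathfrak g)=\mathcal Z/\mathcal B$. Fix a nonzero $\zeta\in\Lambda^4(\mathfrak g)$ inducing the orientation. Since $\mathfrak g$ is unimodular, $\Phi_\zeta(\alpha,\beta)=(\alpha\wedge\beta)(\zeta)$ induces a symmetric bilinear form $\bar\Phi_\zeta$ on $H^2(\mathfrak g)$. Let $b^+(\mathfrak g)$ be the maximal dimension of a subspace of $H^2(\mathfrak g)$ on which $\bar\Phi_\zeta$ is positive definite. Let $J$ be an almost complex structure on $\mathfrak g$, i.e. a linear automorphism with $J^2=-\mathrm{id}$, such that the orientation induced by $J$ (bases of the form $(v,Jv,w,Jw)$ are positive) is the given one. Let $\Lambda_J^\pm(\mathfrak g^*)=\{\alpha\in\Lambda^2(\mathfrak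 g^*) : \alpha(J\cdot,J\cdot)=\pm\alpha\}$, let $H_J^\pm(\mathfrak g)\subset H^2(\mathfrak g)$ be the subspace of classes $[\alpha]$ with $\alpha\in\mathcal Z\cap\Lambda_J^\pm(\mathfrak g^*)$, and let $h_J^\pm=\dim H_J^\pm(\mathfrak g)$. Call $J$ tamed if there is $\omega\in\mathcal Z$ with $\omega(v,Jv)>0$ for every nonzero $v\in\mathfrak g$. Then $h_J^-=b^+(\mathfrak g)$ or $h_J^-=b^+(\mathfrak g)-1$. Moreover, the following are equivalent: 0. $J$ is tamed; 1. $\mathcal B\cap\Lambda_J^+(\mathfrak g^*)=\{0\}$; 2. $h_J^+=b^+(\mathfrak g)+1$; 3. $h_J^-=b^+(\mathfrak g)-1$; 4. the restriction of $\bar\Phi_\zeta$ to $H_J^+(\mathfrak g)$ is nondegenerate of signature $(1,b^+(\mathfrak g))$. -/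

import Mathlib

set_option maxSynthPendingDepth 3

namespace AlmostComplexLie

section LinearAlgebra

theorem sum_perm_four (f : Fin 4 → Fin 4 → Fin 4 → Fin 4 → ℝ) :
    ∑ σ : Equiv.Perm (Fin 4), ((Equiv.Perm.sign σ : ℤ) : ℝ) * f (σ 0) (σ 1) (σ 2) (σ 3) =
      f 0 1 2 3 - f 0 1 3 2 - f 0 2 1 3 + f 0 2 3 1 + f 0 3 1 2 - f 0 3 2 1
      - f 1 0 2 3 + f 1 0 3 2 + f 1 2 0 3 - f 1 2 3 0 - f 1 3 0 2 + f 1 3 2 0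
      + f 2 0 1 3 - f 2 0 3 1 - f 2 1 0 3 + f 2 1 3 0 + f 2 3 0 1 - f 2 3 1 0
      - f 3 0 1 2 + f 3 0 2 1 + f 3 1 0 2 - f 3 1 2 0 - f 3 2 0 1 + f 3 2 1 0 := by
  rw [← Equiv.Perm.decomposeFin.symm.sum_comp, Fintype.sum_prod_type]
  simp only [Equiv.Perm.decomposeFin.symm_sign, Equiv.Perm.decomposeFin_symm_apply_zero]
  have e1 : ∀ (p : Fin 4) (e : Equiv.Perm (Fin 3)), Equiv.Perm.decomposeFin.symm (p, e) 1 = Equiv.swap 0 p (e 0).succ := fun p e => Equiv.Perm.decomposeFin_symm_apply_succ e p 0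
  have e2 : ∀ (p : Fin 4) (e : Equiv.Perm (Fin 3)), Equiv.Perm.decomposeFin.symm (p, e) 2 = Equiv.swap 0 p (e 1).succ := fun p e => Equiv.Perm.decomposeFin_symm_apply_succ e p 1
  have e3 : ∀ (p : Fin 4) (e : Equiv.Perm (Fin 3)), Equiv.Perm.decomposeFin.symm (p, e) 3 = Equiv.swap 0 p (e 2).succ := fun p e => Equiv.Perm.decomposeFin_symm_apply_succ e p 2
  simp only [e1, e2, e3]
  simp only [← (Equiv.Perm.decomposeFin (n := 2)).symm.sum_comp, Fintype.sum_prod_type]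
  have e1 : ∀ (p : Fin 3) (e : Equiv.Perm (Fin 2)), Equiv.Perm.decomposeFin.symm (p, e) 1 = Equiv.swap 0 p (e 0).succ := fun p e => Equiv.Perm.decomposeFin_symm_apply_succ e p 0
  have e2 : ∀ (p : Fin 3) (e : Equiv.Perm (Fin 2)), Equiv.Perm.decomposeFin.symm (p, e) 2 = Equiv.swap 0 p (e 1).succ := fun p e => Equiv.Perm.decomposeFin_symm_apply_succ e p 1
  simp only [Equiv.Perm.decomposeFin.symm_sign, Equiv.Perm.decomposeFin_symm_apply_zero, e1, e2]
  have u : (Finset.univ : Finset (Equiv.Perm (Fin 2))) = {1, Equiv.swap 0 1} := by decide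
  have a1 : Equiv.swap (0:Fin 4) 1 2 = 2 := by decide
  have a2 : Equiv.swap (0:Fin 4) 1 3 = 3 := by decide
  have a3 : Equiv.swap (0:Fin 4) 2 1 = 1 := by decide
  have a4 : Equiv.swap (0:Fin 4) 2 3 = 3 := by decide
  have a5 : Equiv.swap (0:Fin 4) 3 1 = 1 := by decide
  have a6 : Equiv.swap (0:Fin 4) 3 2 = 2 := by decide
  have b1 : Equiv.swap (0:Fin 3) 1 2 = 2 := by decide
  have b2 : Equiv.swap (0:Fin 3) 2 1 = 1 := by decide
  have c1 : Fin.succ (1 : Fin 3) = 2 := rfl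
  have c2 : Fin.succ (2 : Fin 3) = 3 := rfl
  have c3 : Fin.succ (1 : Fin 2) = 2 := rfl
  have nn : (1 : Equiv.Perm (Fin 2)) ≠ Equiv.swap 0 1 := by decide
  simp only [u, Finset.sum_pair nn, Fin.sum_univ_four, Fin.sum_univ_three]
  simp [a1,a2,a3,a4,a5,a6,b1,b2,c1,c2,c3]
  ring

theorem two_form_swap {V : Type*} [AddCommGroup V] [Module ℝ V]
    (α : V [⋀^Fin 2]→ₗ[ℝ] ℝ) (x y : V) : α ![x, y] = - α ![y, x] := by
  have := α.map_swap ![y, x] (i := 0) (j := 1) (by decide)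
  rw [← this]
  congr 1
  ext i
  fin_cases i <;> simp

/-- A 2-form on `V`, as a bilinear form. -/
def toBilin {V : Type*} [AddCommGroup V] [Module ℝ V] (α : V [⋀^Fin 2]→ₗ[ℝ] ℝ) :
    V →ₗ[ℝ] V →ₗ[ℝ] ℝ :=
  LinearMap.mk₂ ℝ (fun x y => α ![x, y])
    (fun x y z => α.map_vecCons_add ![z] x y)
    (fun c x y => α.map_vecCons_smul ![y] c x)
    (fun x y z => by
      rw [two_form_swap α x, two_form_swap α x y, two_form_swap α x z, ← neg_add]
      exact congrArg Neg.neg (α.map_vecCons_add ![x] y z))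
    (fun c x y => by
      rw [two_form_swap α x, two_form_swap α x y, smul_neg]
      exact congrArg Neg.neg (α.map_vecCons_smul ![x] c y))

@[simp] theorem toBilin_apply {V : Type*} [AddCommGroup V] [Module ℝ V]
    (α : V [⋀^Fin 2]→ₗ[ℝ] ℝ) (x y : V) : toBilin α x y = α ![x, y] := rfl

theorem toBilin_self {V : Type*} [AddCommGroup V] [Module ℝ V]
    (α : V [⋀^Fin 2]→ₗ[ℝ] ℝ) (x : V) : toBilin α x x = 0 := by
  have := two_form_swap α x x
  rw [toBilin_apply]
  linarith

theorem toBilin_swap {V : Type*} [AddCommGroup V] [Module ℝ V]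
    (α : V [⋀^Fin 2]→ₗ[ℝ] ℝ) (x y : V) : toBilin α x y = - toBilin α y x :=
  two_form_swap α x y

/-- The wedge product of two 2-forms (shuffle convention, so that
`(a ∧ b)(x, y) = a x * b y - a y * b x` in degree one). -/
noncomputable def wedge {V : Type*} [AddCommGroup V] [Module ℝ V]
    (α β : V [⋀^Fin 2]→ₗ[ℝ] ℝ) : V [⋀^Fin 4]→ₗ[ℝ] ℝ :=
  ((LinearMap.mul' ℝ ℝ).compAlternatingMap (α.domCoprod β)).domDomCongr
    (finSumFinEquiv : Fin 2 ⊕ Fin 2 ≃ Fin 4)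

theorem wedge_apply {V : Type*} [AddCommGroup V] [Module ℝ V] (α β : V [⋀^Fin 2]→ₗ[ℝ] ℝ) (v : Fin 4 → V) :
    wedge α β v =
      α ![v 0, v 1] * β ![v 2, v 3] - α ![v 0, v 2] * β ![v 1, v 3]
      + α ![v 0, v 3] * β ![v 1, v 2] + α ![v 1, v 2] * β ![v 0, v 3]
      - α ![v 1, v 3] * β ![v 0, v 2] + α ![v 2, v 3] * β ![v 0, v 1] := by
  have h := MultilinearMap.domCoprod_alternization_eq α β
  have h2 := congrArg (fun f => (LinearMap.mul' ℝ ℝ) (f (v ∘ finSumFinEquiv))) h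
  simp only [MultilinearMap.alternatization_apply, map_sum] at h2
  rw [← (Equiv.permCongr (finSumFinEquiv : Fin 2 ⊕ Fin 2 ≃ Fin 4).symm).sum_comp] at h2
  have h3 := sum_perm_four (fun i j k l => α ![v i, v j] * β ![v k, v l])
  have h4 : ∀ w : Fin 2 → V, w = ![w 0, w 1] := fun w => by
    ext i; fin_cases i <;> rfl
  have h5 : ∀ σ : Equiv.Perm (Fin 4),
      (LinearMap.mul' ℝ ℝ) (Equiv.Perm.sign ((finSumFinEquiv : Fin 2 ⊕ Fin 2 ≃ Fin 4).symm.permCongr σ) •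
        (MultilinearMap.domDomCongr ((finSumFinEquiv : Fin 2 ⊕ Fin 2 ≃ Fin 4).symm.permCongr σ)
          (MultilinearMap.domCoprod (α : MultilinearMap ℝ (fun _ => V) ℝ) (β : MultilinearMap ℝ (fun _ => V) ℝ))) (v ∘ finSumFinEquiv)) =
      ((Equiv.Perm.sign σ : ℤ) : ℝ) * (α ![v (σ 0), v (σ 1)] * β ![v (σ 2), v (σ 3)]) := by
    intro σ
    rw [Equiv.Perm.sign_permCongr, MultilinearMap.domDomCongr_apply,
      MultilinearMap.domCoprod_apply, Units.smul_def, ← Int.cast_smul_eq_zsmul ℝ, map_smul, LinearMap.mul'_apply, smul_eq_mul]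
    congr 2
    · simp only [AlternatingMap.coe_multilinearMap]
      rw [h4 (fun _ => _)]
      simp [Equiv.permCongr_apply]
      rfl
    · simp only [AlternatingMap.coe_multilinearMap]
      rw [h4 (fun _ => _)]
      simp [Equiv.permCongr_apply]
      rfl
  rw [Finset.sum_congr rfl (fun σ _ => h5 σ), h3] at h2
  have h6 : wedge α β v = (LinearMap.mul' ℝ ℝ) ((α.domCoprod β) (v ∘ finSumFinEquiv)) := rfl
  simp only [AlternatingMap.smul_apply, map_nsmul, ← h6, Fintype.card_fin] at h2
  simp only [two_form_swap α (v 1) (v 0), two_form_swap α (v 2) (v 0), two_form_swap α (v 3) (v 0),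
    two_form_swap α (v 2) (v 1), two_form_swap α (v 3) (v 1), two_form_swap α (v 3) (v 2),
    two_form_swap β (v 1) (v 0), two_form_swap β (v 2) (v 0), two_form_swap β (v 3) (v 0),
    two_form_swap β (v 2) (v 1), two_form_swap β (v 3) (v 1), two_form_swap β (v 3) (v 2)] at h2
  simp [Nat.factorial] at h2
  linarith

/-- The pairing `Φ_ζ(α, β) = (α ∧ β)(ζ)` of 2-forms defined by a 4-vector `ζ`. -/
noncomputable def formPairing {V : Type*} [AddCommGroup V] [Module ℝ V] (ζ : ⋀[ℝ]^4 V) :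
    LinearMap.BilinForm ℝ (V [⋀^Fin 2]→ₗ[ℝ] ℝ) :=
  LinearMap.mk₂ ℝ (fun α β => exteriorPower.alternatingMapLinearEquiv (wedge α β) ζ)
    (fun α₁ α₂ β => by
      have h : wedge (α₁ + α₂) β = wedge α₁ β + wedge α₂ β := by
        ext v; simp only [wedge_apply, AlternatingMap.add_apply]; ring
      rw [h, map_add, LinearMap.add_apply])
    (fun c α β => by
      have h : wedge (c • α) β = c • wedge α β := by
        ext v; simp only [wedge_apply, AlternatingMap.smul_apply, smul_eq_mul]; ring
      rw [h, map_smul, LinearMap.smul_apply])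
    (fun α β₁ β₂ => by
      have h : wedge α (β₁ + β₂) = wedge α β₁ + wedge α β₂ := by
        ext v; simp only [wedge_apply, AlternatingMap.add_apply]; ring
      rw [h, map_add, LinearMap.add_apply])
    (fun c α β => by
      have h : wedge α (c • β) = c • wedge α β := by
        ext v; simp only [wedge_apply, AlternatingMap.smul_apply, smul_eq_mul]; ring
      rw [h, map_smul, LinearMap.smul_apply])

theorem formPairing_apply {V : Type*} [AddCommGroup V] [Module ℝ V] (ζ : ⋀[ℝ]^4 V)
    (α β : V [⋀^Fin 2]→ₗ[ℝ] ℝ) :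
    formPairing ζ α β = exteriorPower.alternatingMapLinearEquiv (wedge α β) ζ := rfl

theorem formPairing_comm {V : Type*} [AddCommGroup V] [Module ℝ V] (ζ : ⋀[ℝ]^4 V)
    (α β : V [⋀^Fin 2]→ₗ[ℝ] ℝ) : formPairing ζ α β = formPairing ζ β α := by
  have h : wedge α β = wedge β α := by
    ext v; simp only [wedge_apply]; ring
  rw [formPairing_apply, formPairing_apply, h]

/-- `ζ` is a nonzero 4-vector inducing the orientation `o`: it is `e₀ ∧ e₁ ∧ e₂ ∧ e₃` for a
basis `e` of orientation `o`. -/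
def IsPositiveFourVector {V : Type*} [AddCommGroup V] [Module ℝ V]
    (o : Orientation ℝ V (Fin 4)) (ζ : ⋀[ℝ]^4 V) : Prop :=
  ∃ e : Module.Basis (Fin 4) ℝ V, e.orientation = o ∧ ζ = exteriorPower.ιMulti ℝ 4 e

/-- `J` is an almost complex structure: a linear automorphism with `J² = -id`. -/
def IsAlmostComplex {V : Type*} [AddCommGroup V] [Module ℝ V] (J : V →ₗ[ℝ] V) : Prop :=
  J ∘ₗ J = -LinearMap.id

/-- The natural orientation of the 4-dimensional space `V` induced by the almost complex
structure `J` is `o`: every basis of the form `(v, Jv, w, Jw)` has orientation `o`. -/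
def InducesOrientation {V : Type*} [AddCommGroup V] [Module ℝ V] (J : V →ₗ[ℝ] V)
    (o : Orientation ℝ V (Fin 4)) : Prop :=
  ∀ e : Module.Basis (Fin 4) ℝ V, e 1 = J (e 0) → e 3 = J (e 2) → e.orientation = o

/-- `Λ_J^+`, the `J`-invariant 2-forms: `α(Jx, Jy) = α(x, y)`. -/
def invariantForms {V : Type*} [AddCommGroup V] [Module ℝ V] (J : V →ₗ[ℝ] V) :
    Submodule ℝ (V [⋀^Fin 2]→ₗ[ℝ] ℝ) where
  carrier := {α | α.compLinearMap J = α}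
  add_mem' := by
    intro α β hα hβ
    simp only [Set.mem_ofPred_eq] at *
    rw [AlternatingMap.add_compLinearMap, hα, hβ]
  zero_mem' := by simp
  smul_mem' := by
    intro c α hα
    simp only [Set.mem_ofPred_eq] at *
    ext v
    simpa using congrArg (fun f => c * f v) hα

/-- `Λ_J^-`, the `J`-anti-invariant 2-forms: `α(Jx, Jy) = -α(x, y)`. -/
def antiInvariantForms {V : Type*} [AddCommGroup V] [Module ℝ V] (J : V →ₗ[ℝ] V) :
    Submodule ℝ (V [⋀^Fin 2]→ₗ[ℝ] ℝ) where
  carrier := {α | α.compLinearMap J = -α}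
  add_mem' := by
    intro α β hα hβ
    simp only [Set.mem_ofPred_eq] at *
    rw [AlternatingMap.add_compLinearMap, hα, hβ, neg_add]
  zero_mem' := by simp
  smul_mem' := by
    intro c α hα
    simp only [Set.mem_ofPred_eq] at *
    ext v
    simpa using congrArg (fun f => c * f v) hα

/-- The quadratic form `Q` on a real vector space has signature `(p, q)`: `p` and `q` are the
maximal dimensions of subspaces on which `Q` is positive, resp. negative, definite, and `Q` is
nondegenerate, i.e. `p + q` is the dimension of the space. -/
def HasSignature {V : Type*} [AddCommGroup V] [Module ℝ V] (Q : QuadraticForm ℝ V)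
    (p q : ℕ) : Prop :=
  sigPos Q = p ∧ sigNeg Q = q ∧ Module.finrank ℝ V = p + q

end LinearAlgebra

section Cohomology

/-- A real Lie algebra is unimodular if every adjoint map has trace zero. -/
def IsUnimodular (g : Type*) [LieRing g] [LieAlgebra ℝ g] : Prop :=
  ∀ x : g, LinearMap.trace ℝ g (LieAlgebra.ad ℝ g x) = 0

/-- The Chevalley–Eilenberg differential of a 1-form: `(dφ)(x, y) = -φ([x, y])`. -/
def d₁ (g : Type*) [LieRing g] [LieAlgebra ℝ g] : Module.Dual ℝ g →ₗ[ℝ] g [⋀^Fin 2]→ₗ[ℝ] ℝ where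
  toFun φ :=
    { toFun := fun v => - φ ⁅v 0, v 1⁆
      map_update_add' := by
        intro inst v i x y
        obtain rfl : inst = instDecidableEqFin 2 := Subsingleton.elim _ _
        fin_cases i <;> simp <;> ring
      map_update_smul' := by
        intro inst v i c x
        obtain rfl : inst = instDecidableEqFin 2 := Subsingleton.elim _ _
        fin_cases i <;> simp
      map_eq_zero_of_eq' := by
        intro v i j hv hij
        fin_cases i <;> fin_cases j <;> simp_all }
  map_add' φ ψ := by ext v; simp; ring
  map_smul' c φ := by ext v; simp

@[simp] theorem d₁_apply {g : Type*} [LieRing g] [LieAlgebra ℝ g] (φ : Module.Dual ℝ g)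
    (v : Fin 2 → g) : d₁ g φ v = - φ ⁅v 0, v 1⁆ := rfl

theorem toBilin_d₁ {g : Type*} [LieRing g] [LieAlgebra ℝ g] (φ : Module.Dual ℝ g) (x y : g) :
    toBilin (d₁ g φ) x y = - φ ⁅x, y⁆ := rfl

/-- The Chevalley–Eilenberg differential of a 2-form:
`(dα)(x, y, z) = -α([x, y], z) + α([x, z], y) - α([y, z], x)`. -/
def d₂ (g : Type*) [LieRing g] [LieAlgebra ℝ g] :
    (g [⋀^Fin 2]→ₗ[ℝ] ℝ) →ₗ[ℝ] g [⋀^Fin 3]→ₗ[ℝ] ℝ where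
  toFun α :=
    { toFun := fun v => - α ![⁅v 0, v 1⁆, v 2] + α ![⁅v 0, v 2⁆, v 1] - α ![⁅v 1, v 2⁆, v 0]
      map_update_add' := by
        intro inst v i x y
        obtain rfl : inst = instDecidableEqFin 3 := Subsingleton.elim _ _
        simp only [← toBilin_apply]
        fin_cases i <;> simp [-toBilin_apply] <;> ring
      map_update_smul' := by
        intro inst v i c x
        obtain rfl : inst = instDecidableEqFin 3 := Subsingleton.elim _ _
        simp only [← toBilin_apply]
        fin_cases i <;> simp [-toBilin_apply] <;> ring
      map_eq_zero_of_eq' := by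
        intro v i j hv hij
        have hs : ∀ x y z : g, toBilin α ⁅x, y⁆ z = - toBilin α ⁅y, x⁆ z := fun x y z => by
          rw [← lie_skew, map_neg, LinearMap.neg_apply]
        simp only [← toBilin_apply]
        have key : ∀ x y z : g, (x = y ∨ x = z ∨ y = z) →
            - toBilin α ⁅x, y⁆ z + toBilin α ⁅x, z⁆ y - toBilin α ⁅y, z⁆ x = 0 := by
          rintro x y z (rfl | rfl | rfl)
          · simp [-toBilin_apply]
          · have := hs x y x
            simp only [lie_self, map_zero, LinearMap.zero_apply]
            linarith
          · simp [-toBilin_apply]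
        apply key
        fin_cases i <;> fin_cases j <;>
          first
          | exact absurd rfl hij
          | exact Or.inl hv
          | exact Or.inl hv.symm
          | exact Or.inr (Or.inl hv)
          | exact Or.inr (Or.inl hv.symm)
          | exact Or.inr (Or.inr hv)
          | exact Or.inr (Or.inr hv.symm) }
  map_add' α β := by ext v; simp; ring
  map_smul' c α := by ext v; simp; ring

theorem d₂_apply {g : Type*} [LieRing g] [LieAlgebra ℝ g] (α : g [⋀^Fin 2]→ₗ[ℝ] ℝ)
    (v : Fin 3 → g) :
    d₂ g α v = - α ![⁅v 0, v 1⁆, v 2] + α ![⁅v 0, v 2⁆, v 1] - α ![⁅v 1, v 2⁆, v 0] := rfl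

/-- `𝒵`, the closed 2-forms. -/
def closedForms (g : Type*) [LieRing g] [LieAlgebra ℝ g] : Submodule ℝ (g [⋀^Fin 2]→ₗ[ℝ] ℝ) :=
  LinearMap.ker (d₂ g)

/-- `ℬ`, the exact 2-forms. -/
def exactForms (g : Type*) [LieRing g] [LieAlgebra ℝ g] : Submodule ℝ (g [⋀^Fin 2]→ₗ[ℝ] ℝ) :=
  LinearMap.range (d₁ g)

theorem exactForms_le_closedForms (g : Type*) [LieRing g] [LieAlgebra ℝ g] :
    exactForms g ≤ closedForms g := by
  rintro _ ⟨φ, rfl⟩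
  rw [closedForms, LinearMap.mem_ker]
  ext v
  rw [d₂_apply]
  simp only [d₁_apply, Matrix.cons_val_zero, Matrix.cons_val_one, AlternatingMap.zero_apply]
  have h := congrArg φ (lie_jacobi (v 0) (v 1) (v 2))
  rw [← lie_skew (v 0) ⁅v 1, v 2⁆, ← lie_skew (v 1) ⁅v 2, v 0⁆, ← lie_skew (v 2) ⁅v 0, v 1⁆,
    ← lie_skew (v 2) (v 0)] at h
  simp only [map_add, map_neg, neg_lie, map_zero] at h
  linarith

/-- The second Chevalley–Eilenberg cohomology `H²(g) = 𝒵 / ℬ`. -/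
abbrev H2 (g : Type*) [LieRing g] [LieAlgebra ℝ g] : Type _ :=
  closedForms g ⧸ (exactForms g).submoduleOf (closedForms g)

/-- The cohomology class of a closed 2-form. -/
abbrev cohomologyClass (g : Type*) [LieRing g] [LieAlgebra ℝ g] : closedForms g →ₗ[ℝ] H2 g :=
  ((exactForms g).submoduleOf (closedForms g)).mkQ

/-- On a unimodular Lie algebra of dimension four, closed and exact 2-forms are orthogonal for
the wedge product. -/
theorem wedge_exact_eq_zero {g : Type*} [LieRing g] [LieAlgebra ℝ g]
    (hdim : Module.finrank ℝ g = 4) (hU : IsUnimodular g)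
    {α : g [⋀^Fin 2]→ₗ[ℝ] ℝ} (hα : α ∈ closedForms g) (φ : Module.Dual ℝ g) :
    wedge α (d₁ g φ) = 0 := by
  have : FiniteDimensional ℝ g := Module.finite_of_finrank_eq_succ hdim
  let e : Module.Basis (Fin 4) ℝ g := Module.finBasisOfFinrankEq ℝ g hdim
  rw [← AlternatingMap.map_basis_eq_zero_iff e, wedge_apply]
  have hc : ∀ x y z : g, - toBilin α ⁅x, y⁆ z + toBilin α ⁅x, z⁆ y - toBilin α ⁅y, z⁆ x = 0 :=
    fun x y z => congrArg (fun f => f ![x, y, z]) hα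
  have hb : ∀ i j, ⁅e i, e j⁆ = ∑ k, e.repr ⁅e i, e j⁆ k • e k := fun i j => (e.sum_repr _).symm
  have ht : ∀ i, ∑ j, e.repr ⁅e i, e j⁆ j = 0 := by
    intro i
    rw [← hU (e i), LinearMap.trace_eq_matrix_trace ℝ e, Matrix.trace]
    simp [LinearMap.toMatrix_apply]
  have hs : ∀ i j k, e.repr ⁅e i, e j⁆ k = - e.repr ⁅e j, e i⁆ k := by
    intro i j k
    rw [← lie_skew, map_neg, Finsupp.neg_apply]
  have hz : ∀ i k, e.repr ⁅e i, e i⁆ k = 0 := by simp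
  have c0 := hc (e 1) (e 2) (e 3)
  have c1 := hc (e 0) (e 2) (e 3)
  have c2 := hc (e 0) (e 1) (e 3)
  have c3 := hc (e 0) (e 1) (e 2)
  have t0 := ht 0
  have t1 := ht 1
  have t2 := ht 2
  have t3 := ht 3
  simp only [← toBilin_apply, toBilin_d₁]
  generalize hC : (fun i j k => e.repr ⁅e i, e j⁆ k) = C at *
  have hC' : ∀ i j k, e.repr ⁅e i, e j⁆ k = C i j k := fun i j k => by rw [← hC]
  simp only [hC'] at hb ht hs hz t0 t1 t2 t3
  simp only [hb, Fin.sum_univ_four, map_add, map_smul, LinearMap.add_apply, LinearMap.smul_apply,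
    smul_eq_mul, toBilin_self, toBilin_swap α (e 1) (e 0), toBilin_swap α (e 2) (e 0),
    toBilin_swap α (e 3) (e 0), toBilin_swap α (e 2) (e 1), toBilin_swap α (e 3) (e 1),
    toBilin_swap α (e 3) (e 2)] at c0 c1 c2 c3 ⊢
  simp only [Fin.sum_univ_four, hz, hs 1 0, hs 2 0, hs 3 0, hs 2 1, hs 3 1, hs 3 2]
    at t0 t1 t2 t3
  linear_combination φ (e 0) * c0 - φ (e 1) * c1 + φ (e 2) * c2 - φ (e 3) * c3
    - (toBilin α (e 1) (e 2) * φ (e 3) - toBilin α (e 1) (e 3) * φ (e 2)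
      + toBilin α (e 2) (e 3) * φ (e 1)) * t0
    + (toBilin α (e 0) (e 2) * φ (e 3) - toBilin α (e 0) (e 3) * φ (e 2)
      + toBilin α (e 2) (e 3) * φ (e 0)) * t1
    - (toBilin α (e 0) (e 1) * φ (e 3) - toBilin α (e 0) (e 3) * φ (e 1)
      + toBilin α (e 1) (e 3) * φ (e 0)) * t2
    + (toBilin α (e 0) (e 1) * φ (e 2) - toBilin α (e 0) (e 2) * φ (e 1)
      + toBilin α (e 1) (e 2) * φ (e 0)) * t3

theorem formPairing_exact_eq_zero {g : Type*} [LieRing g] [LieAlgebra ℝ g]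
    (hdim : Module.finrank ℝ g = 4) (hU : IsUnimodular g) (ζ : ⋀[ℝ]^4 g)
    {α β : g [⋀^Fin 2]→ₗ[ℝ] ℝ} (hα : α ∈ closedForms g) (hβ : β ∈ exactForms g) :
    formPairing ζ α β = 0 := by
  obtain ⟨φ, rfl⟩ := hβ
  rw [formPairing_apply, wedge_exact_eq_zero hdim hU hα, map_zero, LinearMap.zero_apply]

/-- The pairing induced by `Φ_ζ` on `H²(g)`, for `g` unimodular of dimension four:
`([α], [β]) ↦ (α ∧ β)(ζ)`. -/
noncomputable def cohomologyPairing {g : Type*} [LieRing g] [LieAlgebra ℝ g]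
    (hdim : Module.finrank ℝ g = 4) (hU : IsUnimodular g) (ζ : ⋀[ℝ]^4 g) :
    LinearMap.BilinForm ℝ (H2 g) :=
  ((exactForms g).submoduleOf (closedForms g)).liftQ
    (LinearMap.flip (((exactForms g).submoduleOf (closedForms g)).liftQ
      ((formPairing ζ).domRestrict₁₂ (closedForms g) (closedForms g))
      (fun β hβ => by
        rw [LinearMap.mem_ker]
        ext α
        rw [LinearMap.domRestrict₁₂_apply, formPairing_comm]
        exact formPairing_exact_eq_zero hdim hU ζ α.2 hβ)))
    (fun β hβ => by
      rw [LinearMap.mem_ker]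
      ext α
      exact formPairing_exact_eq_zero hdim hU ζ α.2 hβ)

@[simp] theorem cohomologyPairing_mk {g : Type*} [LieRing g] [LieAlgebra ℝ g]
    (hdim : Module.finrank ℝ g = 4) (hU : IsUnimodular g) (ζ : ⋀[ℝ]^4 g)
    (α β : closedForms g) :
    cohomologyPairing hdim hU ζ (cohomologyClass g α) (cohomologyClass g β) =
      formPairing ζ (α : g [⋀^Fin 2]→ₗ[ℝ] ℝ) (β : g [⋀^Fin 2]→ₗ[ℝ] ℝ) :=
  formPairing_comm ζ _ _

/-- The quadratic form `[α] ↦ (α ∧ α)(ζ)` on `H²(g)`. -/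
noncomputable def intersectionForm {g : Type*} [LieRing g] [LieAlgebra ℝ g]
    (hdim : Module.finrank ℝ g = 4) (hU : IsUnimodular g) (ζ : ⋀[ℝ]^4 g) :
    QuadraticForm ℝ (H2 g) :=
  (cohomologyPairing hdim hU ζ).toQuadraticMap

/-- `b⁺(g)`, the maximal dimension of a positive definite subspace of `H²(g)`. -/
noncomputable def bPlus {g : Type*} [LieRing g] [LieAlgebra ℝ g]
    (hdim : Module.finrank ℝ g = 4) (hU : IsUnimodular g) (ζ : ⋀[ℝ]^4 g) : ℕ :=
  sigPos (intersectionForm hdim hU ζ)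

/-- `H_J^+(g)`, the classes in `H²(g)` of closed `J`-invariant 2-forms. -/
def HPlus {g : Type*} [LieRing g] [LieAlgebra ℝ g] (J : g →ₗ[ℝ] g) : Submodule ℝ (H2 g) :=
  ((invariantForms J).submoduleOf (closedForms g)).map (cohomologyClass g)

/-- `H_J^-(g)`, the classes in `H²(g)` of closed `J`-anti-invariant 2-forms. -/
def HMinus {g : Type*} [LieRing g] [LieAlgebra ℝ g] (J : g →ₗ[ℝ] g) : Submodule ℝ (H2 g) :=
  ((antiInvariantForms J).submoduleOf (closedForms g)).map (cohomologyClass g)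

/-- `h_J^+`, the dimension of `H_J^+(g)`. -/
noncomputable def hPlus {g : Type*} [LieRing g] [LieAlgebra ℝ g] (J : g →ₗ[ℝ] g) : ℕ :=
  Module.finrank ℝ (HPlus J)

/-- `h_J^-`, the dimension of `H_J^-(g)`. -/
noncomputable def hMinus {g : Type*} [LieRing g] [LieAlgebra ℝ g] (J : g →ₗ[ℝ] g) : ℕ :=
  Module.finrank ℝ (HMinus J)

/-- `J` is tamed: there is a closed 2-form `ω` with `ω(v, Jv) > 0` for all nonzero `v`. -/
def IsTamed {g : Type*} [LieRing g] [LieAlgebra ℝ g] (J : g →ₗ[ℝ] g) : Prop :=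
  ∃ ω ∈ closedForms g, ∀ v : g, v ≠ 0 → 0 < ω ![v, J v]

end Cohomology
end AlmostComplexLie

/-! Everything reduces to the wedge pairing `Φ` on the 6-dimensional space of 2-forms, which is
nondegenerate of signature (3,3). Write `Z`, `B` for the closed and exact forms and `b = dim B`.
Unimodularity means that exact 4-forms vanish, and this gives `Z = B^⊥`
(`closedForms_eq_orthogonal`). So `B` is isotropic, and `H² = B^⊥/B` is nondegenerate of signature
`(3 - b, 3 - b)` (`signature_intersectionForm`).

The structure `J` splits the 2-forms orthogonally into `Λ⁺`, of signature (1,3), and `Λ⁻`, positive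
definite of dimension 2. Hence `B ∩ Λ⁻ = 0`, while `k = dim (B ∩ Λ⁺)` is at most 1. Since `Z ∩ Λ^∓ =
(B + Λ^±)^⊥`, counting dimensions gives `h⁻ = 2 - b + k = b⁺ - 1 + k` and `h⁺ = 4 - b - k = b⁺ + 1 -
k`. The dichotomy and the equivalence of the two dimension conditions with `k = 0` follow.

For taming, an invariant form is a Hermitian form on a complex plane and its square is, up to a
positive factor, the determinant; positive square therefore means definite. If a closed form tames
`J`, its invariant part has positive square and is orthogonal to `B ∩ Λ⁺`. The orthogonal complement
of a positive vector in signature (1,3) is negative definite and `B` is isotropic, so `k = 0`.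
Conversely, if `k = 0` then `H⁺` has signature `(1, b⁺)`; a closed invariant representative of a
positive class is definite, so it or its negative tames `J`. -/

namespace AlmostComplexLie

/-! ### Linear algebra of 2-forms on a four-dimensional space -/

section TwoForms

variable {V : Type*} [AddCommGroup V] [Module ℝ V]

theorem isAlmostComplex_apply {J : V →ₗ[ℝ] V} (hJ : IsAlmostComplex J) (v : V) :
    J (J v) = -v := by
  simpa using LinearMap.congr_fun hJ v

theorem vec_two_eq {X : Type*} (w : Fin 2 → X) : w = ![w 0, w 1] := by
  ext i; fin_cases i <;> rfl

theorem two_form_neg_right (α : V [⋀^Fin 2]→ₗ[ℝ] ℝ) (x y : V) : α ![x, -y] = -α ![x, y] :=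
  (toBilin α x).map_neg y

theorem two_form_neg_left (α : V [⋀^Fin 2]→ₗ[ℝ] ℝ) (x y : V) : α ![-x, y] = -α ![x, y] :=
  (toBilin α).map_neg₂ x y

/-- In dimension four, any three linearly independent vectors are the last three of a basis. -/
theorem exists_basis_succ (hdim : Module.finrank ℝ V = 4) {v : Fin 3 → V}
    (hv : LinearIndependent ℝ v) : ∃ e : Module.Basis (Fin 4) ℝ V, ∀ i, e i.succ = v i := by
  have : FiniteDimensional ℝ V := Module.finite_of_finrank_eq_succ hdim
  have h1 : Submodule.span ℝ (Set.range v) ≠ ⊤ := by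
    intro h
    have h2 := finrank_range_le_card (R := ℝ) v
    rw [Set.finrank, h, finrank_top, hdim] at h2
    simp at h2
  obtain ⟨w, -, hw⟩ := SetLike.exists_of_lt (lt_top_iff_ne_top.2 h1)
  have h3 : LinearIndependent ℝ (Fin.cons w v : Fin 4 → V) :=
    linearIndependent_finCons.2 ⟨hv, hw⟩
  refine ⟨basisOfLinearIndependentOfCardEqFinrank h3 (by simp [hdim]), fun i => ?_⟩
  simp

/-- A complex structure on a four-dimensional space has an adapted basis `(v, Jv, w, Jw)`. -/
theorem exists_adapted_basis (hdim : Module.finrank ℝ V = 4) {J : V →ₗ[ℝ] V}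
    (hJ : IsAlmostComplex J) :
    ∃ e : Module.Basis (Fin 4) ℝ V, e 1 = J (e 0) ∧ e 3 = J (e 2) := by
  have : FiniteDimensional ℝ V := Module.finite_of_finrank_eq_succ hdim
  have : Nontrivial V := Module.nontrivial_of_finrank_pos (R := ℝ) (by omega)
  have hJJ := isAlmostComplex_apply hJ
  obtain ⟨v, hv⟩ := exists_ne (0 : V)
  have h1 : Submodule.span ℝ (Set.range ![v, J v]) ≠ ⊤ := by
    intro h
    have h2 := finrank_range_le_card (R := ℝ) ![v, J v]
    rw [Set.finrank, h, finrank_top, hdim] at h2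
    simp at h2
  obtain ⟨w, -, hw⟩ := SetLike.exists_of_lt (lt_top_iff_ne_top.2 h1)
  -- The quotient by a `J`-stable subspace is a complex vector space: applying `p - qJ` to `(p +
  -- qJ)u` gives `(p² + q²)u`. This is used for the plane of `v` and then for the zero subspace.
  have key : ∀ (S : Submodule ℝ V), (∀ x ∈ S, J x ∈ S) → ∀ u ∉ S, ∀ p q : ℝ,
      p • u + q • J u ∈ S → p = 0 ∧ q = 0 := by
    intro S hS u hu p q h
    have h2 : (p * p + q * q) • u ∈ S := by
      have h3 := S.sub_mem (S.smul_mem p h) (S.smul_mem q (hS _ h))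
      convert h3 using 1
      simp only [map_add, map_smul, hJJ]
      module
    by_contra hpq
    have h3 : p * p + q * q ≠ 0 := fun h0 => hpq ⟨by nlinarith, by nlinarith⟩
    exact hu ((S.smul_mem_iff h3).1 h2)
  have hli : LinearIndependent ℝ ![v, J v, w, J w] := by
    rw [Fintype.linearIndependent_iff]
    intro c hc
    simp only [Fin.sum_univ_four, Matrix.cons_val] at hc
    have hS : ∀ x ∈ Submodule.span ℝ (Set.range ![v, J v]),
        J x ∈ Submodule.span ℝ (Set.range ![v, J v]) := by
      intro x hx
      simp only [Matrix.range_cons, Matrix.range_empty, Set.union_empty, Set.singleton_union,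
        Submodule.mem_span_pair] at hx ⊢
      obtain ⟨a, b, rfl⟩ := hx
      refine ⟨-b, a, ?_⟩
      simp only [map_add, map_smul, hJJ]
      module
    obtain ⟨h2, h3⟩ := key _ hS w hw (c 2) (c 3) (by
      have : c 2 • w + c 3 • J w = (-c 0) • v + (-c 1) • J v := by
        rw [← sub_eq_zero, ← hc]; module
      rw [this]
      simp only [Matrix.range_cons, Matrix.range_empty, Set.union_empty, Set.singleton_union,
        Submodule.mem_span_pair]
      exact ⟨_, _, rfl⟩)
    obtain ⟨h0, h1⟩ := key ⊥ (by simp) v (by simpa using hv) (c 0) (c 1) (by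
      rw [h2, h3] at hc
      simpa using hc)
    intro i
    fin_cases i <;> assumption
  refine ⟨basisOfLinearIndependentOfCardEqFinrank hli (by simp [hdim]), ?_, ?_⟩ <;> simp

theorem finrank_twoForms (hdim : Module.finrank ℝ V = 4) :
    Module.finrank ℝ (V [⋀^Fin 2]→ₗ[ℝ] ℝ) = 6 := by
  have : FiniteDimensional ℝ V := Module.finite_of_finrank_eq_succ hdim
  rw [(exteriorPower.alternatingMapLinearEquiv (R := ℝ) (M := V) (N := ℝ) (n := 2)).finrank_eq]
  rw [show Module.finrank ℝ (⋀[ℝ]^2 V →ₗ[ℝ] ℝ) = Module.finrank ℝ (⋀[ℝ]^2 V) from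
    Subspace.dual_finrank_eq, exteriorPower.finrank_eq, hdim]
  rfl

theorem twoForm_ext (e : Module.Basis (Fin 4) ℝ V) {α β : V [⋀^Fin 2]→ₗ[ℝ] ℝ}
    (h01 : α ![e 0, e 1] = β ![e 0, e 1]) (h02 : α ![e 0, e 2] = β ![e 0, e 2])
    (h03 : α ![e 0, e 3] = β ![e 0, e 3]) (h12 : α ![e 1, e 2] = β ![e 1, e 2])
    (h13 : α ![e 1, e 3] = β ![e 1, e 3]) (h23 : α ![e 2, e 3] = β ![e 2, e 3]) : α = β := by
  refine e.ext_alternating fun v hv => ?_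
  rw [vec_two_eq (fun i => e (v i))]
  generalize v 0 = i
  generalize v 1 = j
  have hs : ∀ i j, α ![e j, e i] = β ![e j, e i] → α ![e i, e j] = β ![e i, e j] := fun i j h => by
    rw [two_form_swap α, two_form_swap β, h]
  have h0 : ∀ i, α ![e i, e i] = β ![e i, e i] := fun i =>
    (toBilin_self α (e i)).trans (toBilin_self β (e i)).symm
  fin_cases i <;> fin_cases j <;> first | exact h0 _ | assumption | (apply hs; assumption)

/-- The positive factor relating `Φ_ζ` to the value of the wedge product on a positive basis. -/
theorem formPairing_eq_smul {o : Orientation ℝ V (Fin 4)} {ζ : ⋀[ℝ]^4 V}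
    (hζ : IsPositiveFourVector o ζ) (e : Module.Basis (Fin 4) ℝ V) (he : e.orientation = o) :
    ∃ c : ℝ, 0 < c ∧ ∀ α β, formPairing ζ α β = c * wedge α β e := by
  obtain ⟨b, hb, rfl⟩ := hζ
  -- 4-forms make up a line, so replacing the basis `b` that defines `ζ` by `e` costs only a
  -- determinant, positive because the orientations agree.
  refine ⟨e.det b, (e.orientation_eq_iff_det_pos b).1 (he.trans hb.symm), fun α β => ?_⟩
  rw [formPairing_apply, exteriorPower.alternatingMapLinearEquiv_apply_ιMulti,
    (wedge α β).eq_smul_basis_det e, AlternatingMap.smul_apply, smul_eq_mul]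
  rw [AlternatingMap.smul_apply, e.det_self, smul_eq_mul, mul_one, mul_comm]

/-- The linear map whose kernel consists of the (anti-)self-dual 2-forms for the metric with
orthonormal basis `e`, for `ε = 1` and `ε = -1` respectively. -/
noncomputable def dualityDefect (e : Module.Basis (Fin 4) ℝ V) (ε : ℝ) :
    (V [⋀^Fin 2]→ₗ[ℝ] ℝ) →ₗ[ℝ] (Fin 3 → ℝ) where
  toFun := fun α => ![α ![e 0, e 1] - ε * α ![e 2, e 3], α ![e 0, e 2] + ε * α ![e 1, e 3],
    α ![e 0, e 3] - ε * α ![e 1, e 2]]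
  map_add' := fun α β => by ext i; fin_cases i <;> simp <;> ring
  map_smul' := fun c α => by ext i; fin_cases i <;> simp <;> ring

/-- The (anti-)self-dual 2-forms for the metric with orthonormal basis `e`, for `ε = 1` and
`ε = -1` respectively. -/
noncomputable def dualForms (e : Module.Basis (Fin 4) ℝ V) (ε : ℝ) :
    Submodule ℝ (V [⋀^Fin 2]→ₗ[ℝ] ℝ) :=
  LinearMap.ker (dualityDefect e ε)

theorem mem_dualForms {e : Module.Basis (Fin 4) ℝ V} {ε : ℝ} {α : V [⋀^Fin 2]→ₗ[ℝ] ℝ} :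
    α ∈ dualForms e ε ↔ α ![e 0, e 1] = ε * α ![e 2, e 3] ∧
      α ![e 0, e 2] = -(ε * α ![e 1, e 3]) ∧ α ![e 0, e 3] = ε * α ![e 1, e 2] := by
  simp only [dualForms, dualityDefect, LinearMap.mem_ker, LinearMap.coe_mk, AddHom.coe_mk, funext_iff,
    Fin.forall_fin_succ]
  simp [sub_eq_zero, add_eq_zero_iff_eq_neg]

theorem three_le_finrank_dualForms (hdim : Module.finrank ℝ V = 4)
    (e : Module.Basis (Fin 4) ℝ V) (ε : ℝ) : 3 ≤ Module.finrank ℝ (dualForms e ε) := by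
  have : FiniteDimensional ℝ (V [⋀^Fin 2]→ₗ[ℝ] ℝ) :=
    Module.finite_of_finrank_eq_succ (finrank_twoForms hdim)
  rw [dualForms]
  have h := (dualityDefect e ε).finrank_range_add_finrank_ker
  have h2 := (LinearMap.range (dualityDefect e ε)).finrank_le
  rw [finrank_twoForms hdim] at h
  simp only [Module.finrank_fin_fun] at h2
  omega

/-- The duality relations turn the square into `2ε` times a sum of three squares of coefficients;
the extra factor `ε` handles both signs at once. -/
theorem mul_wedge_self_pos_of_mem_dualForms (e : Module.Basis (Fin 4) ℝ V) {ε : ℝ} (hε : ε ≠ 0)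
    {α : V [⋀^Fin 2]→ₗ[ℝ] ℝ} (hα : α ∈ dualForms e ε) (h0 : α ≠ 0) : 0 < ε * wedge α α e := by
  obtain ⟨h1, h2, h3⟩ := mem_dualForms.1 hα
  rw [wedge_apply, h1, h2, h3]
  have : α ![e 2, e 3] ≠ 0 ∨ α ![e 1, e 3] ≠ 0 ∨ α ![e 1, e 2] ≠ 0 := by
    by_contra! h
    obtain ⟨h4, h5, h6⟩ := h
    apply h0
    apply twoForm_ext e <;> simp [*]
  have hε2 : 0 < ε * ε := mul_self_pos.2 hε
  have : 0 < α ![e 2, e 3] ^ 2 + α ![e 1, e 3] ^ 2 + α ![e 1, e 2] ^ 2 := by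
    rcases this with h | h | h <;> positivity
  have := mul_pos hε2 this
  linarith

theorem wedge_eq_zero_of_mem_dualForms (e : Module.Basis (Fin 4) ℝ V)
    {α β : V [⋀^Fin 2]→ₗ[ℝ] ℝ} (hα : α ∈ dualForms e 1) (hβ : β ∈ dualForms e (-1)) :
    wedge α β e = 0 := by
  obtain ⟨h1, h2, h3⟩ := mem_dualForms.1 hα
  obtain ⟨h4, h5, h6⟩ := mem_dualForms.1 hβ
  rw [wedge_apply, h1, h2, h3, h4, h5, h6]
  ring

theorem compLinearMap_pair (J : V →ₗ[ℝ] V) (α : V [⋀^Fin 2]→ₗ[ℝ] ℝ) (x y : V) :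
    α.compLinearMap J ![x, y] = α ![J x, J y] := by
  rw [AlternatingMap.compLinearMap_apply, vec_two_eq (fun i => J (![x, y] i))]
  rfl

theorem mem_invariantForms {J : V →ₗ[ℝ] V} {α : V [⋀^Fin 2]→ₗ[ℝ] ℝ} :
    α ∈ invariantForms J ↔ ∀ x y, α ![J x, J y] = α ![x, y] := by
  change α.compLinearMap J = α ↔ _
  constructor
  · intro h x y
    rw [← compLinearMap_pair, h]
  · intro h
    ext v
    rw [vec_two_eq v, compLinearMap_pair, h]

theorem mem_antiInvariantForms {J : V →ₗ[ℝ] V} {α : V [⋀^Fin 2]→ₗ[ℝ] ℝ} :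
    α ∈ antiInvariantForms J ↔ ∀ x y, α ![J x, J y] = -α ![x, y] := by
  change α.compLinearMap J = -α ↔ _
  constructor
  · intro h x y
    rw [← compLinearMap_pair, h, AlternatingMap.neg_apply]
  · intro h
    ext v
    rw [vec_two_eq v, compLinearMap_pair, h, AlternatingMap.neg_apply]

/-! ### Invariant and anti-invariant forms in a basis `(v, Jv, w, Jw)` -/

section Adapted

variable {J : V →ₗ[ℝ] V} (hJ : IsAlmostComplex J) {e : Module.Basis (Fin 4) ℝ V}
  (h1 : e 1 = J (e 0)) (h3 : e 3 = J (e 2))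
include hJ h1 h3

theorem coeff_of_mem_invariantForms {α : V [⋀^Fin 2]→ₗ[ℝ] ℝ} (hα : α ∈ invariantForms J) :
    α ![e 1, e 3] = α ![e 0, e 2] ∧ α ![e 1, e 2] = -α ![e 0, e 3] := by
  rw [mem_invariantForms] at hα
  refine ⟨by rw [h1, h3, hα], ?_⟩
  rw [← hα (e 0) (e 3), ← h1, h3, isAlmostComplex_apply hJ]
  rw [two_form_neg_right, neg_neg]

theorem coeff_of_mem_antiInvariantForms {α : V [⋀^Fin 2]→ₗ[ℝ] ℝ}
    (hα : α ∈ antiInvariantForms J) :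
    α ![e 0, e 1] = 0 ∧ α ![e 2, e 3] = 0 ∧
    α ![e 1, e 3] = -α ![e 0, e 2] ∧ α ![e 1, e 2] = α ![e 0, e 3] := by
  rw [mem_antiInvariantForms] at hα
  have hJJ := isAlmostComplex_apply hJ
  have hself : ∀ x, α ![x, J x] = 0 := fun x => by
    have h := hα x (J x)
    simp only [← toBilin_apply, hJJ, map_neg] at h ⊢
    rw [toBilin_swap α (J x) x] at h
    linarith
  refine ⟨by rw [h1, hself], by rw [h3, hself], by rw [h1, h3, hα], ?_⟩
  have h := hα (e 0) (e 3)
  simp only [← toBilin_apply, ← h1, h3, hJJ, map_neg] at h ⊢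
  linarith

theorem wedge_eq_zero_of_invariant_of_antiInvariant {α β : V [⋀^Fin 2]→ₗ[ℝ] ℝ}
    (hα : α ∈ invariantForms J) (hβ : β ∈ antiInvariantForms J) : wedge α β e = 0 := by
  obtain ⟨a1, a2⟩ := coeff_of_mem_invariantForms hJ h1 h3 hα
  obtain ⟨b1, b2, b3, b4⟩ := coeff_of_mem_antiInvariantForms hJ h1 h3 hβ
  rw [wedge_apply, a1, a2, b1, b2, b3, b4]
  ring

/-- Anti-invariant forms are the real parts of (2,0)-forms, hence self-dual. This is the source of
their positivity. -/
theorem antiInvariantForms_le_dualForms : antiInvariantForms J ≤ dualForms e 1 := by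
  intro β hβ
  obtain ⟨b1, b2, b3, b4⟩ := coeff_of_mem_antiInvariantForms hJ h1 h3 hβ
  rw [mem_dualForms, b1, b2, b3, b4]
  simp

/-- Anti-self-dual forms are the primitive (1,1)-forms. They supply a negative definite 3-space
inside the invariant forms. -/
theorem dualForms_neg_one_le_invariantForms : dualForms e (-1) ≤ invariantForms J := by
  intro α hα
  obtain ⟨a1, a2, a3⟩ := mem_dualForms.1 hα
  have hJ1 : J (e 1) = -e 0 := by rw [h1, isAlmostComplex_apply hJ]
  have hJ3 : J (e 3) = -e 2 := by rw [h3, isAlmostComplex_apply hJ]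
  have s01 := two_form_swap α (e 0) (e 1)
  have s23 := two_form_swap α (e 2) (e 3)
  have s03 := two_form_swap α (e 0) (e 3)
  have s12 := two_form_swap α (e 1) (e 2)
  change α.compLinearMap J = α
  apply twoForm_ext e <;> rw [compLinearMap_pair] <;>
    simp only [hJ1, hJ3, ← h1, ← h3, two_form_neg_left,
    two_form_neg_right] <;>
    linarith

omit h1 h3 in
theorem isCompl_invariantForms_antiInvariantForms :
    IsCompl (invariantForms J) (antiInvariantForms J) := by
  have hJJ := isAlmostComplex_apply hJ
  constructor
  · rw [Submodule.disjoint_def]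
    intro α hp hm
    ext v
    rw [vec_two_eq v]
    have := (mem_invariantForms.1 hp (v 0) (v 1)).symm.trans
      (mem_antiInvariantForms.1 hm (v 0) (v 1))
    rw [AlternatingMap.zero_apply]
    linarith
  · rw [codisjoint_iff, eq_top_iff]
    intro α _
    have hn : ∀ x y, α ![-x, -y] = α ![x, y] := fun x y => by
      rw [two_form_neg_left, two_form_neg_right, neg_neg]
    -- Pullback by `J` is an involution on 2-forms, since `J² = -1` acts trivially in even degree;
    -- these are its eigenprojections.
    refine Submodule.mem_sup.2 ⟨(1 / 2 : ℝ) • (α + α.compLinearMap J), ?_,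
      (1 / 2 : ℝ) • (α - α.compLinearMap J), ?_, by module⟩
    · rw [mem_invariantForms]
      intro x y
      simp only [AlternatingMap.smul_apply, AlternatingMap.add_apply, compLinearMap_pair, hJJ, hn]
      rw [add_comm]
    · rw [mem_antiInvariantForms]
      intro x y
      simp only [AlternatingMap.smul_apply, AlternatingMap.sub_apply, compLinearMap_pair, hJJ, hn, smul_eq_mul]
      ring

/-- Upper bounds suffice here and for the invariant forms: the two spaces are complementary in
dimension 6 = 2 + 4, which forces equality. -/
theorem finrank_antiInvariantForms_le : Module.finrank ℝ (antiInvariantForms J) ≤ 2 := by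
  let f : antiInvariantForms J →ₗ[ℝ] (Fin 2 → ℝ) :=
    { toFun := fun α => ![α.1 ![e 0, e 2], α.1 ![e 0, e 3]]
      map_add' := fun α β => by ext i; fin_cases i <;> simp
      map_smul' := fun c α => by ext i; fin_cases i <;> simp }
  have hf : Function.Injective f := by
    rw [injective_iff_map_eq_zero]
    rintro ⟨α, hα⟩ h
    obtain ⟨b1, b2, b3, b4⟩ := coeff_of_mem_antiInvariantForms hJ h1 h3 hα
    have g0 : α ![e 0, e 2] = 0 := congrFun h 0
    have g1 : α ![e 0, e 3] = 0 := congrFun h 1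
    apply Subtype.ext
    apply twoForm_ext e <;> simp [b1, b2, b3, b4, g0, g1]
  simpa using LinearMap.finrank_le_finrank_of_injective hf

theorem finrank_invariantForms_le : Module.finrank ℝ (invariantForms J) ≤ 4 := by
  let f : invariantForms J →ₗ[ℝ] (Fin 4 → ℝ) :=
    { toFun := fun α => ![α.1 ![e 0, e 2], α.1 ![e 0, e 3], α.1 ![e 0, e 1], α.1 ![e 2, e 3]]
      map_add' := fun α β => by ext i; fin_cases i <;> simp
      map_smul' := fun c α => by ext i; fin_cases i <;> simp }
  have hf : Function.Injective f := by
    rw [injective_iff_map_eq_zero]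
    rintro ⟨α, hα⟩ h
    obtain ⟨b1, b2⟩ := coeff_of_mem_invariantForms hJ h1 h3 hα
    have g0 : α ![e 0, e 2] = 0 := congrFun h 0
    have g1 : α ![e 0, e 3] = 0 := congrFun h 1
    have g2 : α ![e 0, e 1] = 0 := congrFun h 2
    have g3 : α ![e 2, e 3] = 0 := congrFun h 3
    apply Subtype.ext
    apply twoForm_ext e <;> simp [b1, b2, g0, g1, g2, g3]
  simpa using LinearMap.finrank_le_finrank_of_injective hf

/-- The value of a `J`-invariant form on `(v, Jv)`, in coordinates. -/
theorem invariantForms_apply_self_complex {α : V [⋀^Fin 2]→ₗ[ℝ] ℝ}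
    (hα : α ∈ invariantForms J) (x : Fin 4 → ℝ) :
    α ![∑ i, x i • e i, J (∑ i, x i • e i)] =
      α ![e 0, e 1] * (x 0 ^ 2 + x 1 ^ 2) + α ![e 2, e 3] * (x 2 ^ 2 + x 3 ^ 2)
      + 2 * α ![e 0, e 3] * (x 0 * x 2 + x 1 * x 3)
      + 2 * α ![e 0, e 2] * (x 1 * x 2 - x 0 * x 3) := by
  obtain ⟨b1, b2⟩ := coeff_of_mem_invariantForms hJ h1 h3 hα
  have hJ1 : J (e 1) = -e 0 := by rw [h1, isAlmostComplex_apply hJ]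
  have hJ3 : J (e 3) = -e 2 := by rw [h3, isAlmostComplex_apply hJ]
  simp only [← toBilin_apply] at b1 b2 ⊢
  simp only [Fin.sum_univ_four, map_add, map_smul, LinearMap.add_apply, LinearMap.smul_apply,
    smul_eq_mul, ← h1, ← h3, hJ1, hJ3, map_neg, toBilin_self, toBilin_swap α (e 1) (e 0),
    toBilin_swap α (e 2) (e 0), toBilin_swap α (e 3) (e 0), toBilin_swap α (e 2) (e 1),
    toBilin_swap α (e 3) (e 1), toBilin_swap α (e 3) (e 2), b1, b2]
  ring

theorem wedge_self_of_mem_invariantForms {α : V [⋀^Fin 2]→ₗ[ℝ] ℝ} (hα : α ∈ invariantForms J) :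
    wedge α α e =
      2 * (α ![e 0, e 1] * α ![e 2, e 3] - α ![e 0, e 2] ^ 2 - α ![e 0, e 3] ^ 2) := by
  obtain ⟨b1, b2⟩ := coeff_of_mem_invariantForms hJ h1 h3 hα
  rw [wedge_apply, b1, b2]
  ring

theorem wedge_self_pos_of_taming {α : V [⋀^Fin 2]→ₗ[ℝ] ℝ} (hα : α ∈ invariantForms J)
    (h : ∀ v : V, v ≠ 0 → 0 < α ![v, J v]) : 0 < wedge α α e := by
  rw [wedge_self_of_mem_invariantForms hJ h1 h3 hα]
  have h0 := h (e 0) (e.ne_zero 0)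
  rw [← h1] at h0
  -- This vector annihilates both squares obtained by completing the square in the first two
  -- coordinates, so the Hermitian form takes there the value `α(e 0, e 1)` times the determinant.
  have hx : ∑ i, (![-α ![e 0, e 3], -α ![e 0, e 2], α ![e 0, e 1], 0] : Fin 4 → ℝ) i • e i ≠ 0 := by
    intro hx
    have := Fintype.linearIndependent_iff.1 e.linearIndependent _ hx 2
    exact h0.ne' this
  have h2 := h _ hx
  rw [invariantForms_apply_self_complex hJ h1 h3 hα] at h2
  simp only [Matrix.cons_val] at h2
  have : 0 < α ![e 0, e 1] *
      (α ![e 0, e 1] * α ![e 2, e 3] - α ![e 0, e 2] ^ 2 - α ![e 0, e 3] ^ 2) := by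
    nlinarith [h2]
  have := (mul_pos_iff_of_pos_left h0).1 this
  linarith

theorem taming_of_wedge_self_pos {α : V [⋀^Fin 2]→ₗ[ℝ] ℝ} (hα : α ∈ invariantForms J)
    (hpos : 0 < wedge α α e) (h0 : 0 < α ![e 0, e 1]) (v : V) (hv : v ≠ 0) :
    0 < α ![v, J v] := by
  rw [wedge_self_of_mem_invariantForms hJ h1 h3 hα] at hpos
  rw [← e.sum_repr v, invariantForms_apply_self_complex hJ h1 h3 hα]
  have hx : ¬ (e.repr v 0 = 0 ∧ e.repr v 1 = 0 ∧ e.repr v 2 = 0 ∧ e.repr v 3 = 0) := by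
    rintro ⟨g0, g1, g2, g3⟩
    apply hv
    rw [← e.sum_repr v, Fin.sum_univ_four, g0, g1, g2, g3]
    simp
  generalize e.repr v 0 = x0 at *
  generalize e.repr v 1 = x1 at *
  generalize e.repr v 2 = x2 at *
  generalize e.repr v 3 = x3 at *
  generalize α ![e 0, e 1] = a at *
  generalize α ![e 2, e 3] = b at *
  generalize α ![e 0, e 2] = c at *
  generalize α ![e 0, e 3] = d at *
  refine pos_of_mul_pos_right (a := a) ?_ h0.le
  have hD : 0 < a * b - c ^ 2 - d ^ 2 := by linarith
  -- Sylvester's criterion for a 2×2 Hermitian matrix with diagonal `a`, `b` and off-diagonal entry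
  -- of squared modulus `c² + d²`, by completing squares.
  have key : a * (a * (x0 ^ 2 + x1 ^ 2) + b * (x2 ^ 2 + x3 ^ 2) + 2 * d * (x0 * x2 + x1 * x3)
      + 2 * c * (x1 * x2 - x0 * x3)) = (a * x0 + d * x2 - c * x3) ^ 2
      + (a * x1 + d * x3 + c * x2) ^ 2 + (a * b - c ^ 2 - d ^ 2) * (x2 ^ 2 + x3 ^ 2) := by ring
  rw [key]
  by_cases h23 : x2 = 0 ∧ x3 = 0
  · obtain ⟨rfl, rfl⟩ := h23
    have : x0 ≠ 0 ∨ x1 ≠ 0 := by by_contra! h; exact hx ⟨h.1, h.2, rfl, rfl⟩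
    have : 0 < x0 ^ 2 + x1 ^ 2 := by rcases this with h | h <;> positivity
    have := mul_pos (mul_pos h0 h0) this
    linarith
  · have : x2 ≠ 0 ∨ x3 ≠ 0 := by by_contra! h; exact h23 h
    have : 0 < x2 ^ 2 + x3 ^ 2 := by rcases this with h | h <;> positivity
    positivity

/-- A `J`-invariant form of positive square tames `J` up to sign. -/
theorem taming_or_neg_taming {α : V [⋀^Fin 2]→ₗ[ℝ] ℝ} (hα : α ∈ invariantForms J)
    (hpos : 0 < wedge α α e) :
    (∀ v : V, v ≠ 0 → 0 < α ![v, J v]) ∨ ∀ v : V, v ≠ 0 → 0 < (-α) ![v, J v] := by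
  rcases lt_trichotomy (α ![e 0, e 1]) 0 with h | h | h
  · refine Or.inr (taming_of_wedge_self_pos hJ h1 h3 (neg_mem hα) ?_ ?_)
    · rwa [show wedge (-α) (-α) e = wedge α α e by simp [wedge_apply]]
    · simpa using h
  -- A vanishing diagonal entry makes the determinant nonpositive.
  · rw [wedge_self_of_mem_invariantForms hJ h1 h3 hα, h] at hpos
    nlinarith
  · exact Or.inl (taming_of_wedge_self_pos hJ h1 h3 hα hpos h)

end Adapted

end TwoForms

end AlmostComplexLie
namespace AlmostComplexLie

/-! ### The pairing on 2-forms: signature and orthogonal complements -/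

section Pairing

variable {V : Type*} [AddCommGroup V] [Module ℝ V]

theorem finiteDimensional_twoForms (hdim : Module.finrank ℝ V = 4) :
    FiniteDimensional ℝ (V [⋀^Fin 2]→ₗ[ℝ] ℝ) :=
  Module.finite_of_finrank_eq_succ (finrank_twoForms hdim)

theorem finrank_add_finrank_le_of_disjoint_of_le {W : Type*} [AddCommGroup W] [Module ℝ W]
    [FiniteDimensional ℝ W] {P N S : Submodule ℝ W} (hP : P ≤ S) (hN : N ≤ S)
    (h : Disjoint P N) : Module.finrank ℝ P + Module.finrank ℝ N ≤ Module.finrank ℝ S := by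
  rw [← Submodule.finrank_sup_add_finrank_inf_eq, h.eq_bot, finrank_bot, add_zero]
  exact Submodule.finrank_mono (sup_le hP hN)

theorem isRefl_formPairing (ζ : ⋀[ℝ]^4 V) : (formPairing ζ).IsRefl := fun α β h => by
  rw [formPairing_comm, h]

/-- The wedge product pairing on 2-forms has signature `(3, 3)`. -/
theorem exists_definite_subspaces (hdim : Module.finrank ℝ V = 4)
    {o : Orientation ℝ V (Fin 4)} {ζ : ⋀[ℝ]^4 V} (hζ : IsPositiveFourVector o ζ) :
    ∃ P N : Submodule ℝ (V [⋀^Fin 2]→ₗ[ℝ] ℝ),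
      3 ≤ Module.finrank ℝ P ∧ 3 ≤ Module.finrank ℝ N ∧
      (∀ α ∈ P, α ≠ 0 → 0 < formPairing ζ α α) ∧ (∀ α ∈ N, α ≠ 0 → formPairing ζ α α < 0) ∧
      ∀ α ∈ P, ∀ β ∈ N, formPairing ζ α β = 0 := by
  obtain ⟨e, he, -⟩ := id hζ
  obtain ⟨c, hc, h⟩ := formPairing_eq_smul hζ e he
  refine ⟨dualForms e 1, dualForms e (-1), three_le_finrank_dualForms hdim e 1,
    three_le_finrank_dualForms hdim e (-1), fun α hα h0 => ?_, fun α hα h0 => ?_,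
    fun α hα β hβ => by rw [h, wedge_eq_zero_of_mem_dualForms e hα hβ, mul_zero]⟩
  · have := mul_wedge_self_pos_of_mem_dualForms e one_ne_zero hα h0
    rw [h]
    exact mul_pos hc (by linarith)
  · have := mul_wedge_self_pos_of_mem_dualForms e (neg_ne_zero.2 one_ne_zero) hα h0
    rw [h]
    exact mul_neg_of_pos_of_neg hc (by linarith)

/-- A positive and a negative definite 3-space meet in zero, so they fill the six dimensions. They
are orthogonal, so a vector of the radical has both components isotropic in definite spaces. -/
theorem nondegenerate_formPairing (hdim : Module.finrank ℝ V = 4)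
    {o : Orientation ℝ V (Fin 4)} {ζ : ⋀[ℝ]^4 V} (hζ : IsPositiveFourVector o ζ) :
    (formPairing ζ).Nondegenerate := by
  have := finiteDimensional_twoForms hdim
  obtain ⟨P, N, hP, hN, hpos, hneg, hPN⟩ := exists_definite_subspaces hdim hζ
  have hd : Disjoint P N := by
    rw [Submodule.disjoint_def]
    intro α h1 h2
    by_contra h0
    exact lt_asymm (hpos α h1 h0) (hneg α h2 h0)
  have htop : P ⊔ N = ⊤ := by
    apply Submodule.eq_top_of_finrank_eq
    have h1 := Submodule.finrank_sup_add_finrank_inf_eq P N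
    rw [hd.eq_bot, finrank_bot] at h1
    have h2 := (P ⊔ N).finrank_le
    rw [finrank_twoForms hdim] at *
    omega
  refine (LinearMap.IsRefl.nondegenerate_iff_separatingLeft (isRefl_formPairing ζ)).2 ?_
  intro α hα
  obtain ⟨p, hp, n, hn, rfl⟩ := Submodule.mem_sup.1 (htop ▸ Submodule.mem_top : α ∈ P ⊔ N)
  have h1 := hα p
  have h2 := hα n
  rw [map_add, LinearMap.add_apply, formPairing_comm ζ n p, hPN p hp n hn, add_zero] at h1
  rw [map_add, LinearMap.add_apply, hPN p hp n hn, zero_add] at h2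
  have hp0 : p = 0 := by
    by_contra h0
    exact (hpos p hp h0).ne' h1
  have hn0 : n = 0 := by
    by_contra h0
    exact (hneg n hn h0).ne h2
  rw [hp0, hn0, add_zero]

theorem finrank_invariantForms_antiInvariantForms (hdim : Module.finrank ℝ V = 4)
    {J : V →ₗ[ℝ] V} (hJ : IsAlmostComplex J) :
    Module.finrank ℝ (invariantForms J) = 4 ∧ Module.finrank ℝ (antiInvariantForms J) = 2 := by
  have := finiteDimensional_twoForms hdim
  obtain ⟨e, h1, h3⟩ := exists_adapted_basis hdim hJ
  have h4 := finrank_invariantForms_le hJ h1 h3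
  have h2 := finrank_antiInvariantForms_le hJ h1 h3
  have h := Submodule.finrank_add_eq_of_isCompl (isCompl_invariantForms_antiInvariantForms hJ)
  rw [finrank_twoForms hdim] at h
  omega

variable {o : Orientation ℝ V (Fin 4)} {ζ : ⋀[ℝ]^4 V} {J : V →ₗ[ℝ] V}

theorem formPairing_invariant_antiInvariant (hdim : Module.finrank ℝ V = 4)
    (hζ : IsPositiveFourVector o ζ) (hJ : IsAlmostComplex J) (hJo : InducesOrientation J o)
    {α β : V [⋀^Fin 2]→ₗ[ℝ] ℝ} (hα : α ∈ invariantForms J) (hβ : β ∈ antiInvariantForms J) :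
    formPairing ζ α β = 0 := by
  obtain ⟨e, h1, h3⟩ := exists_adapted_basis hdim hJ
  obtain ⟨c, hc, h⟩ := formPairing_eq_smul hζ e (hJo e h1 h3)
  rw [h, wedge_eq_zero_of_invariant_of_antiInvariant hJ h1 h3 hα hβ, mul_zero]

theorem formPairing_self_pos_of_antiInvariant (hdim : Module.finrank ℝ V = 4)
    (hζ : IsPositiveFourVector o ζ) (hJ : IsAlmostComplex J) (hJo : InducesOrientation J o)
    {β : V [⋀^Fin 2]→ₗ[ℝ] ℝ} (hβ : β ∈ antiInvariantForms J) (h0 : β ≠ 0) :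
    0 < formPairing ζ β β := by
  obtain ⟨e, h1, h3⟩ := exists_adapted_basis hdim hJ
  obtain ⟨c, hc, h⟩ := formPairing_eq_smul hζ e (hJo e h1 h3)
  have := mul_wedge_self_pos_of_mem_dualForms e one_ne_zero
    (antiInvariantForms_le_dualForms hJ h1 h3 hβ) h0
  rw [h]
  exact mul_pos hc (by linarith)

/-- The pairing on the `J`-invariant forms is negative definite on a hyperplane. -/
theorem exists_negative_invariant_subspace (hdim : Module.finrank ℝ V = 4)
    (hζ : IsPositiveFourVector o ζ) (hJ : IsAlmostComplex J) (hJo : InducesOrientation J o) :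
    ∃ N ≤ invariantForms J, 3 ≤ Module.finrank ℝ N ∧
      ∀ α ∈ N, α ≠ 0 → formPairing ζ α α < 0 := by
  obtain ⟨e, h1, h3⟩ := exists_adapted_basis hdim hJ
  obtain ⟨c, hc, h⟩ := formPairing_eq_smul hζ e (hJo e h1 h3)
  refine ⟨dualForms e (-1), dualForms_neg_one_le_invariantForms hJ h1 h3,
    three_le_finrank_dualForms hdim e (-1), fun α hα h0 => ?_⟩
  have := mul_wedge_self_pos_of_mem_dualForms e (neg_ne_zero.2 one_ne_zero) hα h0
  rw [h]
  exact mul_neg_of_pos_of_neg hc (by linarith)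

theorem formPairing_self_pos_of_taming (hdim : Module.finrank ℝ V = 4)
    (hζ : IsPositiveFourVector o ζ) (hJ : IsAlmostComplex J) (hJo : InducesOrientation J o)
    {α : V [⋀^Fin 2]→ₗ[ℝ] ℝ} (hα : α ∈ invariantForms J)
    (ht : ∀ v : V, v ≠ 0 → 0 < α ![v, J v]) : 0 < formPairing ζ α α := by
  obtain ⟨e, h1, h3⟩ := exists_adapted_basis hdim hJ
  obtain ⟨c, hc, h⟩ := formPairing_eq_smul hζ e (hJo e h1 h3)
  rw [h]
  exact mul_pos hc (wedge_self_pos_of_taming hJ h1 h3 hα ht)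

theorem taming_or_neg_taming_of_formPairing_pos (hdim : Module.finrank ℝ V = 4)
    (hζ : IsPositiveFourVector o ζ) (hJ : IsAlmostComplex J) (hJo : InducesOrientation J o)
    {α : V [⋀^Fin 2]→ₗ[ℝ] ℝ} (hα : α ∈ invariantForms J) (hpos : 0 < formPairing ζ α α) :
    (∀ v : V, v ≠ 0 → 0 < α ![v, J v]) ∨ ∀ v : V, v ≠ 0 → 0 < (-α) ![v, J v] := by
  obtain ⟨e, h1, h3⟩ := exists_adapted_basis hdim hJ
  obtain ⟨c, hc, h⟩ := formPairing_eq_smul hζ e (hJo e h1 h3)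
  rw [h] at hpos
  exact taming_or_neg_taming hJ h1 h3 hα ((mul_pos_iff_of_pos_left hc).1 hpos)

theorem antiInvariant_apply_self_complex (hJ : IsAlmostComplex J) {β : V [⋀^Fin 2]→ₗ[ℝ] ℝ}
    (hβ : β ∈ antiInvariantForms J) (v : V) : β ![v, J v] = 0 := by
  have h := mem_antiInvariantForms.1 hβ v (J v)
  rw [isAlmostComplex_apply hJ, two_form_neg_right, two_form_swap] at h
  linarith

/-- One inclusion is the orthogonality of the two types, and the dimensions agree: 6 - 4 = 2. -/
theorem orthogonal_invariantForms (hdim : Module.finrank ℝ V = 4)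
    (hζ : IsPositiveFourVector o ζ) (hJ : IsAlmostComplex J) (hJo : InducesOrientation J o) :
    (formPairing ζ).orthogonal (invariantForms J) = antiInvariantForms J := by
  have := finiteDimensional_twoForms hdim
  obtain ⟨h4, h2⟩ := finrank_invariantForms_antiInvariantForms hdim hJ
  have hle : antiInvariantForms J ≤ (formPairing ζ).orthogonal (invariantForms J) :=
    fun β hβ α hα => formPairing_invariant_antiInvariant hdim hζ hJ hJo hα hβ
  refine (Submodule.eq_of_le_of_finrank_eq hle ?_).symm
  rw [LinearMap.BilinForm.finrank_orthogonal (nondegenerate_formPairing hdim hζ),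
    finrank_twoForms hdim, h4, h2]

theorem orthogonal_antiInvariantForms (hdim : Module.finrank ℝ V = 4)
    (hζ : IsPositiveFourVector o ζ) (hJ : IsAlmostComplex J) (hJo : InducesOrientation J o) :
    (formPairing ζ).orthogonal (antiInvariantForms J) = invariantForms J := by
  have := finiteDimensional_twoForms hdim
  rw [← orthogonal_invariantForms hdim hζ hJ hJo,
    LinearMap.BilinForm.orthogonal_orthogonal (nondegenerate_formPairing hdim hζ)
      (isRefl_formPairing ζ)]

/-- In dimension four, the intersection of the orthogonals of two spaces of 2-forms. -/
theorem finrank_orthogonal_inf (hdim : Module.finrank ℝ V = 4)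
    (hζ : IsPositiveFourVector o ζ) (S T : Submodule ℝ (V [⋀^Fin 2]→ₗ[ℝ] ℝ)) :
    Module.finrank ℝ ↥((formPairing ζ).orthogonal S ⊓ (formPairing ζ).orthogonal T) +
      Module.finrank ℝ S + Module.finrank ℝ T = 6 + Module.finrank ℝ ↥(S ⊓ T) := by
  have := finiteDimensional_twoForms hdim
  have h : (formPairing ζ).orthogonal S ⊓ (formPairing ζ).orthogonal T =
      (formPairing ζ).orthogonal (S ⊔ T) := by
    refine le_antisymm (fun α hα β hβ => ?_) (le_inf
      (LinearMap.BilinForm.orthogonal_le le_sup_left)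
      (LinearMap.BilinForm.orthogonal_le le_sup_right))
    obtain ⟨s, hs, t, ht, rfl⟩ := Submodule.mem_sup.1 hβ
    have h1 : formPairing ζ s α = 0 := hα.1 s hs
    have h2 : formPairing ζ t α = 0 := hα.2 t ht
    change formPairing ζ (s + t) α = 0
    rw [map_add, LinearMap.add_apply, h1, h2, add_zero]
  have h1 := Submodule.finrank_sup_add_finrank_inf_eq S T
  have h2 := (S ⊔ T).finrank_le
  rw [h, LinearMap.BilinForm.finrank_orthogonal (nondegenerate_formPairing hdim hζ)]
  rw [finrank_twoForms hdim] at *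
  omega

end Pairing

/-! ### Closed forms as the orthogonal of exact forms, and the signature of cohomology -/

section ClosedExact

variable {g : Type*} [LieRing g] [LieAlgebra ℝ g]

/-- On a unimodular Lie algebra of dimension four, a 2-form orthogonal to all exact forms is
closed. -/
theorem mem_closedForms_of_wedge_exact_eq_zero (hdim : Module.finrank ℝ g = 4)
    (hU : IsUnimodular g) {α : g [⋀^Fin 2]→ₗ[ℝ] ℝ}
    (hα : ∀ φ : Module.Dual ℝ g, wedge α (d₁ g φ) = 0) : α ∈ closedForms g := by
  have : FiniteDimensional ℝ g := Module.finite_of_finrank_eq_succ hdim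
  rw [closedForms, LinearMap.mem_ker]
  ext v
  rw [AlternatingMap.zero_apply]
  -- A 3-form is determined by its values on independent triples, and such a triple can be completed
  -- by a vector `e 0`.
  by_cases hv : LinearIndependent ℝ v
  swap
  · exact (d₂ g α).map_linearDependent v hv
  obtain ⟨e, he⟩ := exists_basis_succ hdim hv
  have hb : ∀ i j, ⁅e i, e j⁆ = ∑ k, e.repr ⁅e i, e j⁆ k • e k := fun i j => (e.sum_repr _).symm
  have ht : ∀ i, ∑ j, e.repr ⁅e i, e j⁆ j = 0 := by
    intro i
    rw [← hU (e i), LinearMap.trace_eq_matrix_trace ℝ e, Matrix.trace]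
    simp [LinearMap.toMatrix_apply]
  have hs : ∀ i j k, e.repr ⁅e i, e j⁆ k = - e.repr ⁅e j, e i⁆ k := by
    intro i j k
    rw [← lie_skew, map_neg, Finsupp.neg_apply]
  have hz : ∀ i k, e.repr ⁅e i, e i⁆ k = 0 := by simp
  have t1 := ht 1
  have t2 := ht 2
  have t3 := ht 3
  -- With `φ` dual to the added vector, `φ ∧ dα` evaluated on `e` is `dα` on the given triple. The
  -- Leibniz rule compares it with `α ∧ dφ`; the discrepancy consists of traces of `ad`, which
  -- vanish.
  have hw := congrArg (fun f : g [⋀^Fin 4]→ₗ[ℝ] ℝ => f e) (hα (e.coord 0))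
  simp only [wedge_apply, ← toBilin_apply, toBilin_d₁, e.coord_apply,
    AlternatingMap.zero_apply] at hw
  have h0 : v 0 = e 1 := (he 0).symm
  have h1 : v 1 = e 2 := (he 1).symm
  have h2 : v 2 = e 3 := (he 2).symm
  rw [d₂_apply, h0, h1, h2]
  simp only [← toBilin_apply]
  rw [hb 1 2, hb 1 3, hb 2 3]
  simp only [Fin.sum_univ_four, map_add, map_smul, LinearMap.add_apply, LinearMap.smul_apply,
    smul_eq_mul, toBilin_self, toBilin_swap α (e 2) (e 1), toBilin_swap α (e 3) (e 1),
    toBilin_swap α (e 3) (e 2)]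
  simp only [Fin.sum_univ_four, hz, hs 1 0, hs 2 0, hs 3 0, hs 2 1, hs 3 1, hs 3 2]
    at t1 t2 t3
  linear_combination hw - toBilin α (e 2) (e 3) * t1 + toBilin α (e 1) (e 3) * t2
    - toBilin α (e 1) (e 2) * t3

theorem closedForms_eq_orthogonal (hdim : Module.finrank ℝ g = 4) (hU : IsUnimodular g)
    {o : Orientation ℝ g (Fin 4)} {ζ : ⋀[ℝ]^4 g} (hζ : IsPositiveFourVector o ζ) :
    closedForms g = (formPairing ζ).orthogonal (exactForms g) := by
  apply le_antisymm
  · intro α hα β hβ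
    change formPairing ζ β α = 0
    rw [formPairing_comm]
    exact formPairing_exact_eq_zero hdim hU ζ hα hβ
  · intro α hα
    obtain ⟨e, he, -⟩ := id hζ
    obtain ⟨c, hc, h⟩ := formPairing_eq_smul hζ e he
    refine mem_closedForms_of_wedge_exact_eq_zero hdim hU fun φ => ?_
    have h1 : formPairing ζ (d₁ g φ) α = 0 := hα _ ⟨φ, rfl⟩
    rw [formPairing_comm, h] at h1
    rw [← AlternatingMap.map_basis_eq_zero_iff e]
    exact (mul_eq_zero.1 h1).resolve_left hc.ne'

/-- The image of a space of 2-forms in cohomology. -/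
def classesOf (S : Submodule ℝ (g [⋀^Fin 2]→ₗ[ℝ] ℝ)) : Submodule ℝ (H2 g) :=
  (S.submoduleOf (closedForms g)).map (cohomologyClass g)

theorem mem_classesOf {S : Submodule ℝ (g [⋀^Fin 2]→ₗ[ℝ] ℝ)} {x : H2 g} :
    x ∈ classesOf S ↔ ∃ α : closedForms g, α.1 ∈ S ∧ cohomologyClass g α = x := Iff.rfl

theorem finrank_submoduleOf_of_le {W : Type*} [AddCommGroup W] [Module ℝ W]
    {S T : Submodule ℝ W} (h : S ≤ T) :
    Module.finrank ℝ (S.submoduleOf T) = Module.finrank ℝ S :=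
  (Submodule.submoduleOfEquivOfLe h).finrank_eq

/-- Rank-nullity for the class map restricted to the closed forms in `S`, whose kernel is the exact
forms in `S`. -/
theorem finrank_classesOf (hdim : Module.finrank ℝ g = 4)
    (S : Submodule ℝ (g [⋀^Fin 2]→ₗ[ℝ] ℝ)) :
    Module.finrank ℝ (classesOf S) + Module.finrank ℝ ↥(exactForms g ⊓ S) =
      Module.finrank ℝ ↥(closedForms g ⊓ S) := by
  have := finiteDimensional_twoForms hdim
  have h := ((cohomologyClass g).domRestrict
    (S.submoduleOf (closedForms g))).finrank_range_add_finrank_ker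
  rw [LinearMap.range_domRestrict] at h
  have h1 : Module.finrank ℝ (S.submoduleOf (closedForms g)) =
      Module.finrank ℝ ↥(closedForms g ⊓ S) := by
    rw [← Submodule.finrank_map_subtype_eq (closedForms g) (S.submoduleOf (closedForms g)),
      Submodule.submoduleOf, Submodule.map_comap_subtype]
  have h2 : Module.finrank ℝ (LinearMap.ker ((cohomologyClass g).domRestrict
      (S.submoduleOf (closedForms g)))) = Module.finrank ℝ ↥(exactForms g ⊓ S) := by
    rw [← finrank_submoduleOf_of_le (inf_le_left.trans (exactForms_le_closedForms g) :
      exactForms g ⊓ S ≤ closedForms g), LinearMap.ker_domRestrict, Submodule.ker_mkQ,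
      ← Submodule.finrank_map_subtype_eq, Submodule.submoduleOf, Submodule.map_comap_subtype]
    have hk : (S.submoduleOf (closedForms g)) ⊓ (exactForms g).submoduleOf (closedForms g) =
        (exactForms g ⊓ S).submoduleOf (closedForms g) := by
      rw [inf_comm]
      rfl
    rw [← hk]
    rfl
  rw [h1, h2] at h
  exact h

variable (hdim : Module.finrank ℝ g = 4) (hU : IsUnimodular g)

theorem intersectionForm_mk (ζ : ⋀[ℝ]^4 g) (α : closedForms g) :
    intersectionForm hdim hU ζ (cohomologyClass g α) =
      formPairing ζ (α : g [⋀^Fin 2]→ₗ[ℝ] ℝ) (α : g [⋀^Fin 2]→ₗ[ℝ] ℝ) :=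
  cohomologyPairing_mk hdim hU ζ α α

/-- A definite subspace of cohomology lifts to a semidefinite space of forms, so its dimension is
bounded by the codimension of any space of forms which is definite of the opposite sign. -/
theorem finrank_definite_classes_le (ζ : ⋀[ℝ]^4 g) (ε : ℝ)
    {S N : Submodule ℝ (g [⋀^Fin 2]→ₗ[ℝ] ℝ)} (hNS : N ≤ S)
    (hN : ∀ α ∈ N, α ≠ 0 → ε * formPairing ζ α α < 0)
    {P : Submodule ℝ (H2 g)} (hPS : P ≤ classesOf S)
    (hP : ∀ x ∈ P, x ≠ 0 → 0 < ε * intersectionForm hdim hU ζ x) :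
    Module.finrank ℝ P + Module.finrank ℝ ↥(exactForms g ⊓ S) + Module.finrank ℝ N ≤
      Module.finrank ℝ S := by
  have := finiteDimensional_twoForms hdim
  -- `L` consists of all closed representatives in `S` of classes in `P`. It contains the exact
  -- forms of `S`, so its dimension is `dim P + dim (B ∩ S)`; it is semidefinite of sign `ε`, hence
  -- meets `N` only in zero.
  let L : Submodule ℝ (g [⋀^Fin 2]→ₗ[ℝ] ℝ) :=
    (P.comap (cohomologyClass g)).map (closedForms g).subtype ⊓ S
  have hL : ∀ α, α ∈ L ↔ (∃ a : closedForms g, cohomologyClass g a ∈ P ∧ a.1 = α) ∧ α ∈ S :=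
    fun α => Iff.rfl
  have hcl : classesOf L = P := by
    ext x
    rw [mem_classesOf]
    constructor
    · rintro ⟨α, hα, rfl⟩
      obtain ⟨⟨a, ha, haα⟩, -⟩ := (hL _).1 hα
      rwa [← Subtype.ext haα]
    · intro hx
      obtain ⟨α, hα, rfl⟩ := mem_classesOf.1 (hPS hx)
      exact ⟨α, (hL _).2 ⟨⟨α, hx, rfl⟩, hα⟩, rfl⟩
  have hex : exactForms g ⊓ L = exactForms g ⊓ S := by
    refine le_antisymm (inf_le_inf_left _ inf_le_right) fun α hα => ⟨hα.1, (hL _).2 ⟨?_, hα.2⟩⟩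
    refine ⟨⟨α, exactForms_le_closedForms g hα.1⟩, ?_, rfl⟩
    have h0 : cohomologyClass g ⟨α, exactForms_le_closedForms g hα.1⟩ = 0 := by
      rw [← LinearMap.mem_ker, Submodule.ker_mkQ]
      exact hα.1
    rw [h0]
    exact P.zero_mem
  have hLcl : closedForms g ⊓ L = L := by
    refine inf_eq_right.2 fun α hα => ?_
    obtain ⟨⟨a, -, rfl⟩, -⟩ := (hL _).1 hα
    exact a.2
  have h := finrank_classesOf hdim L
  rw [hcl, hex, hLcl] at h
  rw [h]
  refine finrank_add_finrank_le_of_disjoint_of_le inf_le_right hNS ?_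
  rw [Submodule.disjoint_def]
  intro α hα hαN
  by_contra h0
  obtain ⟨⟨a, ha, rfl⟩, -⟩ := (hL _).1 hα
  have h1 := hN _ hαN h0
  rw [← intersectionForm_mk hdim hU] at h1
  by_cases hx : cohomologyClass g a = 0
  · rw [hx, QuadraticMap.map_zero, mul_zero] at h1
    exact h1.false
  · exact lt_asymm (hP _ ha hx) h1

variable {o : Orientation ℝ g (Fin 4)} {ζ : ⋀[ℝ]^4 g} (hζ : IsPositiveFourVector o ζ)

theorem polar_intersectionForm (ζ : ⋀[ℝ]^4 g) (α β : closedForms g) :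
    QuadraticMap.polar (intersectionForm hdim hU ζ) (cohomologyClass g α) (cohomologyClass g β) =
      2 * formPairing ζ (α : g [⋀^Fin 2]→ₗ[ℝ] ℝ) (β : g [⋀^Fin 2]→ₗ[ℝ] ℝ) := by
  rw [QuadraticMap.polar, ← map_add, intersectionForm_mk, intersectionForm_mk,
    intersectionForm_mk]
  simp only [Submodule.coe_add, map_add, LinearMap.add_apply]
  rw [formPairing_comm ζ β.1 α.1]
  ring

include hζ in
theorem radical_intersectionForm : (intersectionForm hdim hU ζ).radical = ⊥ := by
  have := finiteDimensional_twoForms hdim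
  rw [eq_bot_iff]
  intro x hx
  obtain ⟨α, rfl⟩ := Submodule.mkQ_surjective _ x
  rw [QuadraticMap.radical_eq_ker_polarBilin, LinearMap.mem_ker] at hx
  rw [Submodule.mem_bot, ← LinearMap.mem_ker, Submodule.ker_mkQ]
  change α.1 ∈ exactForms g
  -- A closed form orthogonal to `Z = B^⊥` lies in `B^⊥⊥ = B`, so its class is zero.
  rw [← LinearMap.BilinForm.orthogonal_orthogonal (nondegenerate_formPairing hdim hζ)
      (isRefl_formPairing ζ) (exactForms g), ← closedForms_eq_orthogonal hdim hU hζ]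
  intro β hβ
  have h := LinearMap.congr_fun hx (cohomologyClass g ⟨β, hβ⟩)
  change QuadraticMap.polar _ (cohomologyClass g α) _ = 0 at h
  rw [polar_intersectionForm] at h
  change formPairing ζ β α = 0
  rw [formPairing_comm]
  linarith

include hdim hU hζ in
theorem finrank_closedForms_inf (S : Submodule ℝ (g [⋀^Fin 2]→ₗ[ℝ] ℝ)) :
    Module.finrank ℝ ↥(closedForms g ⊓ (formPairing ζ).orthogonal S) +
      Module.finrank ℝ (exactForms g) + Module.finrank ℝ S =
      6 + Module.finrank ℝ ↥(exactForms g ⊓ S) := by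
  rw [closedForms_eq_orthogonal hdim hU hζ]
  exact finrank_orthogonal_inf hdim hζ _ _

include hdim in
theorem finiteDimensional_H2 : FiniteDimensional ℝ (H2 g) := by
  have := finiteDimensional_twoForms hdim
  infer_instance

theorem classesOf_top : classesOf (⊤ : Submodule ℝ (g [⋀^Fin 2]→ₗ[ℝ] ℝ)) = ⊤ := by
  rw [eq_top_iff]
  intro x _
  obtain ⟨α, rfl⟩ := Submodule.mkQ_surjective _ x
  exact mem_classesOf.2 ⟨α, trivial, rfl⟩

include hdim hU hζ in
theorem finrank_H2 :
    Module.finrank ℝ (H2 g) + 2 * Module.finrank ℝ (exactForms g) = 6 := by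
  have h1 := finrank_classesOf hdim (⊤ : Submodule ℝ (g [⋀^Fin 2]→ₗ[ℝ] ℝ))
  have h2 := finrank_closedForms_inf hdim hU hζ ⊥
  rw [LinearMap.BilinForm.orthogonal_bot, inf_bot_eq, finrank_bot] at h2
  rw [classesOf_top, finrank_top, inf_top_eq] at h1
  omega

include hζ in
/-- `b⁺(g) = b⁻(g) = 3 - dim ℬ`. -/
theorem signature_intersectionForm :
    bPlus hdim hU ζ + Module.finrank ℝ (exactForms g) = 3 ∧
      sigNeg (intersectionForm hdim hU ζ) + Module.finrank ℝ (exactForms g) = 3 := by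
  have := finiteDimensional_twoForms hdim
  have := finiteDimensional_H2 hdim
  obtain ⟨P, N, hP, hN, hpos, hneg, -⟩ := exists_definite_subspaces hdim hζ
  obtain ⟨Hp, hp, hp'⟩ := exists_finrank_eq_sigPos_and_posDef (intersectionForm hdim hU ζ)
  obtain ⟨Hn, hn, hn'⟩ := exists_finrank_eq_sigNeg_and_negDef (intersectionForm hdim hU ζ)
  -- Both indices are at most `6 - 3 - b`. By nondegeneracy they add up to `dim H² = 6 - 2b`, so
  -- both bounds are attained.
  have h1 := finrank_definite_classes_le hdim hU ζ 1 (le_top : N ≤ ⊤)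
    (fun α hα h0 => by rw [one_mul]; exact hneg α hα h0) (P := Hp)
    (by rw [classesOf_top]; exact le_top)
    (fun x hx h0 => by rw [one_mul]; exact hp' ⟨x, hx⟩ (fun h => h0 (congrArg Subtype.val h)))
  have h2 := finrank_definite_classes_le hdim hU ζ (-1) (le_top : P ≤ ⊤)
    (fun α hα h0 => by linarith [hpos α hα h0]) (P := Hn)
    (by rw [classesOf_top]; exact le_top)
    (fun x hx h0 => by
      rw [neg_one_mul]; exact hn' ⟨x, hx⟩ (fun h => h0 (congrArg Subtype.val h)))
  have h3 := QuadraticForm.sigPos_add_sigNeg_add_radical (Q := intersectionForm hdim hU ζ)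
  have h4 := finrank_H2 hdim hU hζ
  rw [radical_intersectionForm hdim hU hζ, finrank_bot] at h3
  rw [inf_top_eq, finrank_top, finrank_twoForms hdim] at h1 h2
  rw [bPlus]
  omega

end ClosedExact

end AlmostComplexLie
namespace AlmostComplexLie

/-! ### Dimensions and signature of `H_J^±`, and the taming criterion -/

section Taming

variable {g : Type*} [LieRing g] [LieAlgebra ℝ g]
  (hdim : Module.finrank ℝ g = 4) (hU : IsUnimodular g)
  {o : Orientation ℝ g (Fin 4)} {ζ : ⋀[ℝ]^4 g} (hζ : IsPositiveFourVector o ζ)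
  {J : g →ₗ[ℝ] g} (hJ : IsAlmostComplex J) (hJo : InducesOrientation J o)
include hdim hU hζ hJ hJo

/-- Exact forms are isotropic, while anti-invariant forms are positive definite. -/
theorem exactForms_inf_antiInvariantForms : exactForms g ⊓ antiInvariantForms J = ⊥ := by
  rw [eq_bot_iff]
  intro α hα
  by_contra h0
  exact (formPairing_self_pos_of_antiInvariant hdim hζ hJ hJo hα.2 h0).ne'
    (formPairing_exact_eq_zero hdim hU ζ (exactForms_le_closedForms g hα.1) hα.1)

/-- The closed anti-invariant forms are `(B + Λ⁺)^⊥`, and none but zero is exact. -/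
theorem hMinus_add_finrank_exactForms :
    hMinus J + Module.finrank ℝ (exactForms g) =
      2 + Module.finrank ℝ ↥(exactForms g ⊓ invariantForms J) := by
  have h1 := finrank_closedForms_inf hdim hU hζ (invariantForms J)
  have h2 := finrank_classesOf hdim (antiInvariantForms J)
  rw [orthogonal_invariantForms hdim hζ hJ hJo,
    (finrank_invariantForms_antiInvariantForms hdim hJ).1] at h1
  rw [exactForms_inf_antiInvariantForms hdim hU hζ hJ hJo, finrank_bot] at h2
  change hMinus J + 0 = _ at h2
  omega

/-- The closed invariant forms are `(B + Λ⁻)^⊥`, of dimension `4 - b` because `B ∩ Λ⁻ = 0`; the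
exact ones among them are then divided out. -/
theorem hPlus_add_finrank_exactForms :
    hPlus J + Module.finrank ℝ ↥(exactForms g ⊓ invariantForms J) +
      Module.finrank ℝ (exactForms g) = 4 := by
  have h1 := finrank_closedForms_inf hdim hU hζ (antiInvariantForms J)
  have h2 := finrank_classesOf hdim (invariantForms J)
  rw [orthogonal_antiInvariantForms hdim hζ hJ hJo,
    (finrank_invariantForms_antiInvariantForms hdim hJ).2,
    exactForms_inf_antiInvariantForms hdim hU hζ hJ hJo, finrank_bot] at h1
  change hPlus J + _ = _ at h2
  omega

theorem finrank_exactForms_inf_invariantForms_le_one :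
    Module.finrank ℝ ↥(exactForms g ⊓ invariantForms J) ≤ 1 := by
  obtain ⟨N, hNS, hN, hneg⟩ := exists_negative_invariant_subspace hdim hζ hJ hJo
  -- With `P = ⊥` the bound concerns the exact invariant forms alone: an isotropic space avoids the
  -- negative 3-space of the 4-dimensional `Λ⁺`.
  have h := finrank_definite_classes_le hdim hU ζ 1 hNS
    (fun α hα h0 => by rw [one_mul]; exact hneg α hα h0) (P := ⊥) bot_le
    (fun x hx h0 => absurd ((Submodule.mem_bot ℝ).1 hx) h0)
  rw [finrank_bot, (finrank_invariantForms_antiInvariantForms hdim hJ).1] at h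
  omega

/-- An exact `J`-invariant form is isotropic and orthogonal to a taming form, hence zero. -/
theorem exactForms_inf_invariantForms_eq_bot_of_isTamed (ht : IsTamed J) :
    exactForms g ⊓ invariantForms J = ⊥ := by
  have := finiteDimensional_twoForms hdim
  obtain ⟨ω, hω, hpos⟩ := ht
  -- The invariant part `p` need not be closed. It still tames `J`, as `m(v, Jv) = 0`, and stays
  -- orthogonal to exact invariant forms, as these are orthogonal to both `ω` and `m`.
  obtain ⟨p, hp, m, hm, rfl⟩ := Submodule.mem_sup.1
    ((isCompl_invariantForms_antiInvariantForms hJ).sup_eq_top ▸ Submodule.mem_top :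
      ω ∈ invariantForms J ⊔ antiInvariantForms J)
  have hpp : 0 < formPairing ζ p p :=
    formPairing_self_pos_of_taming hdim hζ hJ hJo hp fun v hv => by
      have := hpos v hv
      rwa [AlternatingMap.add_apply, antiInvariant_apply_self_complex hJ hm, add_zero] at this
  have hortho : ∀ β ∈ exactForms g ⊓ invariantForms J, formPairing ζ p β = 0 := fun β hβ => by
    have h := formPairing_exact_eq_zero hdim hU ζ hω hβ.1
    rwa [map_add, LinearMap.add_apply, formPairing_comm ζ m,
      formPairing_invariant_antiInvariant hdim hζ hJ hJo hβ.2 hm, add_zero] at h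
  have hiso : ∀ β ∈ exactForms g ⊓ invariantForms J, formPairing ζ β β = 0 := fun β hβ =>
    formPairing_exact_eq_zero hdim hU ζ (exactForms_le_closedForms g hβ.1) hβ.1
  obtain ⟨N, hNS, hN, hneg⟩ := exists_negative_invariant_subspace hdim hζ hJ hJo
  have hp0 : p ≠ 0 := by
    rintro rfl
    simp at hpp
  have h1 : Disjoint (ℝ ∙ p) (exactForms g ⊓ invariantForms J) := by
    rw [disjoint_comm, Submodule.disjoint_span_singleton' hp0]
    exact fun h => hpp.ne' (hortho p h)
  -- On this sum the square of `tp + β` is `t²Φ(p, p) ≥ 0`. Avoiding a negative 3-space inside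
  -- dimension 4, it has dimension at most 1, already used up by `p`.
  have h2 : Disjoint ((ℝ ∙ p) ⊔ exactForms g ⊓ invariantForms J) N := by
    rw [Submodule.disjoint_def]
    intro α hα hαN
    by_contra h0
    have h3 := hneg α hαN h0
    obtain ⟨q, hq, β, hβ, rfl⟩ := Submodule.mem_sup.1 hα
    obtain ⟨t, rfl⟩ := Submodule.mem_span_singleton.1 hq
    simp only [map_add, map_smul, LinearMap.add_apply, LinearMap.smul_apply, smul_eq_mul,
      hiso β hβ, formPairing_comm ζ β p, hortho β hβ] at h3
    nlinarith [mul_nonneg (mul_self_nonneg t) hpp.le]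
  have h3 := finrank_add_finrank_le_of_disjoint_of_le
    (sup_le ((Submodule.span_singleton_le_iff_mem p _).2 hp) inf_le_right) hNS h2
  have h4 := Submodule.finrank_sup_add_finrank_inf_eq (ℝ ∙ p) (exactForms g ⊓ invariantForms J)
  rw [h1.eq_bot, finrank_bot, finrank_span_singleton hp0] at h4
  rw [(finrank_invariantForms_antiInvariantForms hdim hJ).1] at h3
  apply Submodule.finrank_eq_zero.1
  omega

theorem intersectionForm_pos_of_mem_HMinus {x : H2 g} (hx : x ∈ HMinus J) (h0 : x ≠ 0) :
    0 < intersectionForm hdim hU ζ x := by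
  obtain ⟨α, hα, rfl⟩ := mem_classesOf.1 hx
  rw [intersectionForm_mk]
  refine formPairing_self_pos_of_antiInvariant hdim hζ hJ hJo hα fun h => h0 ?_
  rw [show α = 0 from Subtype.ext h, map_zero]

theorem polar_HPlus_HMinus {x y : H2 g} (hx : x ∈ HPlus J) (hy : y ∈ HMinus J) :
    QuadraticMap.polar (intersectionForm hdim hU ζ) x y = 0 := by
  obtain ⟨α, hα, rfl⟩ := mem_classesOf.1 hx
  obtain ⟨β, hβ, rfl⟩ := mem_classesOf.1 hy
  rw [polar_intersectionForm, formPairing_invariant_antiInvariant hdim hζ hJ hJo hα hβ, mul_zero]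

/-- The two spaces are orthogonal and the second is definite, so they are disjoint. In the sum of
their dimensions `k` cancels, leaving `6 - 2b = dim H²`. -/
theorem isCompl_HPlus_HMinus : IsCompl (HPlus J) (HMinus J) := by
  have := finiteDimensional_twoForms hdim
  have := finiteDimensional_H2 hdim
  have hd : Disjoint (HPlus J) (HMinus J) := by
    rw [Submodule.disjoint_def]
    intro x hp hm
    by_contra h0
    have h1 := intersectionForm_pos_of_mem_HMinus hdim hU hζ hJ hJo hm h0
    have h2 := polar_HPlus_HMinus hdim hU hζ hJ hJo hp hm
    rw [QuadraticMap.polar_self, two_smul] at h2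
    linarith
  refine ⟨hd, codisjoint_iff.2 (Submodule.eq_top_of_finrank_eq ?_)⟩
  have h1 := Submodule.finrank_sup_add_finrank_inf_eq (HPlus J) (HMinus J)
  rw [hd.eq_bot, finrank_bot] at h1
  have h2 := hPlus_add_finrank_exactForms hdim hU hζ hJ hJo
  have h3 := hMinus_add_finrank_exactForms hdim hU hζ hJ hJo
  have h4 := finrank_H2 hdim hU hζ
  rw [hPlus] at h2
  rw [hMinus] at h3
  omega

/-- An orthogonal direct summand of a nondegenerate space is nondegenerate. -/
theorem radical_restrict_HPlus :
    ((intersectionForm hdim hU ζ).restrict (HPlus J)).radical = ⊥ := by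
  rw [eq_bot_iff]
  rintro ⟨x, hx⟩ hrad
  rw [QuadraticMap.radical_eq_ker_polarBilin, LinearMap.mem_ker] at hrad
  have h : x ∈ (intersectionForm hdim hU ζ).radical := by
    rw [QuadraticMap.radical_eq_ker_polarBilin, LinearMap.mem_ker]
    refine LinearMap.ext fun y => ?_
    obtain ⟨p, hp, m, hm, rfl⟩ := Submodule.mem_sup.1
      ((isCompl_HPlus_HMinus hdim hU hζ hJ hJo).sup_eq_top ▸ Submodule.mem_top :
        y ∈ HPlus J ⊔ HMinus J)
    have h1 : QuadraticMap.polar (intersectionForm hdim hU ζ) x p = 0 :=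
      LinearMap.congr_fun hrad ⟨p, hp⟩
    have h2 := polar_HPlus_HMinus hdim hU hζ hJ hJo hx hm
    rw [map_add, QuadraticMap.polarBilin_apply_apply, QuadraticMap.polarBilin_apply_apply,
      h1, h2, add_zero, LinearMap.zero_apply]
  rw [radical_intersectionForm hdim hU hζ, Submodule.mem_bot] at h
  exact (Submodule.mem_bot ℝ).2 (Subtype.ext h)

/-- The positive index is at most 1 by the negative 3-space in `Λ⁺`, the negative index at most `b⁻
= b⁺`. Nondegeneracy makes their sum `h⁺ = 4 - b = 1 + b⁺`, so both bounds are equalities. -/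
theorem hasSignature_of_exactForms_inf_invariantForms_eq_bot
    (hk : exactForms g ⊓ invariantForms J = ⊥) :
    HasSignature ((intersectionForm hdim hU ζ).restrict (HPlus J)) 1 (bPlus hdim hU ζ) := by
  have := finiteDimensional_twoForms hdim
  have := finiteDimensional_H2 hdim
  obtain ⟨N, hNS, hN, hneg⟩ := exists_negative_invariant_subspace hdim hζ hJ hJo
  obtain ⟨P, hP, hP'⟩ := exists_finrank_eq_sigPos_and_posDef
    ((intersectionForm hdim hU ζ).restrict (HPlus J))
  obtain ⟨M, hM, hM'⟩ := exists_finrank_eq_sigNeg_and_negDef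
    ((intersectionForm hdim hU ζ).restrict (HPlus J))
  have h1 := finrank_definite_classes_le hdim hU ζ 1 hNS
    (fun α hα h0 => by rw [one_mul]; exact hneg α hα h0) (P := P.map (HPlus J).subtype)
    (Submodule.map_subtype_le _ _) (by
      rintro _ ⟨x, hx, rfl⟩ h0
      rw [one_mul]
      exact hP' ⟨x, hx⟩ fun h => h0 (congrArg (fun z : P => z.1.1) h))
  have h2 := le_sigNeg_of_negDef (intersectionForm hdim hU ζ) (V := M.map (HPlus J).subtype) (by
    rintro ⟨_, x, hx, rfl⟩ h0
    exact hM' ⟨x, hx⟩ fun h => h0 (Subtype.ext (congrArg (fun z : M => z.1.1) h)))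
  have h3 := QuadraticForm.sigPos_add_sigNeg_add_radical
    (Q := (intersectionForm hdim hU ζ).restrict (HPlus J))
  have h4 := hPlus_add_finrank_exactForms hdim hU hζ hJ hJo
  obtain ⟨h5, h6⟩ := signature_intersectionForm hdim hU hζ
  rw [radical_restrict_HPlus hdim hU hζ hJ hJo, finrank_bot] at h3
  rw [Submodule.finrank_map_subtype_eq] at h1 h2
  rw [(finrank_invariantForms_antiInvariantForms hdim hJ).1] at h1
  rw [hk, finrank_bot] at h1 h4
  rw [hPlus] at h4
  refine ⟨?_, ?_, ?_⟩ <;> omega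

theorem isTamed_of_exactForms_inf_invariantForms_eq_bot
    (hk : exactForms g ⊓ invariantForms J = ⊥) : IsTamed J := by
  have := finiteDimensional_twoForms hdim
  have := finiteDimensional_H2 hdim
  obtain ⟨h1, -, -⟩ := hasSignature_of_exactForms_inf_invariantForms_eq_bot hdim hU hζ hJ hJo hk
  obtain ⟨P, hP, hP'⟩ := exists_finrank_eq_sigPos_and_posDef
    ((intersectionForm hdim hU ζ).restrict (HPlus J))
  have hnt : Nontrivial P := Module.nontrivial_of_finrank_pos (R := ℝ) (by omega)
  obtain ⟨x, hx⟩ := exists_ne (0 : P)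
  have hpos : 0 < intersectionForm hdim hU ζ x.1.1 := hP' x hx
  obtain ⟨α, hα, hαx⟩ := mem_classesOf.1 x.1.2
  rw [← hαx, intersectionForm_mk] at hpos
  rcases taming_or_neg_taming_of_formPairing_pos hdim hζ hJ hJo hα hpos with h | h
  · exact ⟨α, α.2, h⟩
  · exact ⟨-α, neg_mem α.2, h⟩

end Taming

end AlmostComplexLie

/-! ### The main theorem -/

theorem theorem3p7 {g : Type*} [LieRing g] [LieAlgebra ℝ g]
    (hdim : Module.finrank ℝ g = 4) (hU : AlmostComplexLie.IsUnimodular g)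
    (o : Orientation ℝ g (Fin 4))
    (ζ : ⋀[ℝ]^4 g) (hζ : AlmostComplexLie.IsPositiveFourVector o ζ)
    (J : g →ₗ[ℝ] g) (hJ : AlmostComplexLie.IsAlmostComplex J)
    (hJo : AlmostComplexLie.InducesOrientation J o) :
    (AlmostComplexLie.hMinus J = AlmostComplexLie.bPlus hdim hU ζ ∨
      (AlmostComplexLie.hMinus J : ℤ) = (AlmostComplexLie.bPlus hdim hU ζ : ℤ) - 1) ∧
    List.TFAE [
      AlmostComplexLie.IsTamed J,
      AlmostComplexLie.exactForms g ⊓ AlmostComplexLie.invariantForms J = ⊥,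
      AlmostComplexLie.hPlus J = AlmostComplexLie.bPlus hdim hU ζ + 1,
      (AlmostComplexLie.hMinus J : ℤ) = (AlmostComplexLie.bPlus hdim hU ζ : ℤ) - 1,
      AlmostComplexLie.HasSignature
        ((AlmostComplexLie.intersectionForm hdim hU ζ).restrict (AlmostComplexLie.HPlus J))
        1 (AlmostComplexLie.bPlus hdim hU ζ)] := by
  have := AlmostComplexLie.finiteDimensional_twoForms hdim
  have hm := AlmostComplexLie.hMinus_add_finrank_exactForms hdim hU hζ hJ hJo
  have hp := AlmostComplexLie.hPlus_add_finrank_exactForms hdim hU hζ hJ hJo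
  have hk := AlmostComplexLie.finrank_exactForms_inf_invariantForms_le_one hdim hU hζ hJ hJo
  obtain ⟨hb, -⟩ := AlmostComplexLie.signature_intersectionForm hdim hU hζ
  have hbot := Submodule.finrank_eq_zero
    (S := AlmostComplexLie.exactForms g ⊓ AlmostComplexLie.invariantForms J)
  -- The collected identities read `h⁻ = b⁺ - 1 + k` and `h⁺ = b⁺ + 1 - k` with `k ≤ 1`.
  refine ⟨by omega, ?_⟩
  tfae_have 1 → 2 :=
    AlmostComplexLie.exactForms_inf_invariantForms_eq_bot_of_isTamed hdim hU hζ hJ hJo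
  tfae_have 2 → 1 :=
    AlmostComplexLie.isTamed_of_exactForms_inf_invariantForms_eq_bot hdim hU hζ hJ hJo
  tfae_have 2 ↔ 3 := by
    rw [← hbot]
    omega
  tfae_have 2 ↔ 4 := by
    rw [← hbot]
    omega
  tfae_have 2 → 5 :=
    AlmostComplexLie.hasSignature_of_exactForms_inf_invariantForms_eq_bot hdim hU hζ hJ hJo
  -- Only the total dimension `1 + b⁺` of the signature is needed.
  tfae_have 5 → 3 := by
    rintro ⟨-, -, h⟩
    rw [AlmostComplexLie.hPlus, h, add_comm]
  tfae_finish
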